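/- Let $k$ be an algebraically closed field of characteristic $p>0$ and let $X\to\mathbb P^1$ be a Harbater–Katz–Gabber cover over $k$ whose Galois group $G$ is a $p$-group: $X$ is a complete non-singular curve, $X\to\mathbb P^1$ is a Galois cover with group $G$, a point $P\in X$ is totally ramified, and all other points of $X$ are unramified over $\mathbb P^1$. Let $F$ be the function field of $X$ and $g=\dim_k H^0(X,\Omega_X)$ its genus. Let $f_0,\dots,f_r\in F$ have no pole outside $P$ and be such that $k(f_0)=F^{G}$ is the function field of $\mathbb P^1$ and $F=k(f_0,\dots,f_r)$ (so $F$ is obtained by the tower $F_1=k(f_0)$, $F_{i+1}=F_i(f_i)$). Let $\bar m_\nu$ be the pole order of $f_\nu$ at $P$, and let $|G_0|=|G|$ be the order of the inertia group $G_0$ at $P$ (this is also the pole order of $f_0$ at $P$). Put $$\mathbf A=\Big\{L=(i_0,\dots,i_r)\in\mathbb N^{r+1}:\ i_0|G_0|+\sum_{\nu=1}^r i_\nu\bar m_\nu\le 2g-2\Big\},$$ and, for $L=(i_0,\dots,i_r)$, $f_L=f_0^{i_0}\cdots f_r^{i_r}$ and $\omega_L=f_L\,df_0$. Then $\omega_L\in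 H^0(X,\Omega_X)$ for every $L\in\mathbf A$, and the set $$G_0^{\mathrm{bin}}=\{\omega_L\omega_K-\omega_{L'}\omega_{K'}\in \mathrm{Sym}\,H^0(X,\Omega_X):\ L,K,L',K'\in\mathbf A,\ L+K=L'+K'\}$$ is contained in the canonical ideal, that is, in the kernel of the canonical map $$\phi:\mathrm{Sym}\,H^0(X,\Omega_X)\to\bigoplus_{n\ge0}H^0(X,\Omega_X^{\otimes n}).$$ -/

import Mathlib

open scoped KaehlerDifferential DirectSum IntermediateField

noncomputable section

namespace HKG

/-! ### Curves through their function fields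

A complete non-singular curve `X` over an algebraically closed field `k` is given by its function
field `F / k`.  Its closed points are the non-trivial valuation rings of `F` containing `k`, and
these are the local rings of `X`. -/

section Curve

variable (k F : Type*) [Field k] [Field F] [Algebra k F]

/-- `O` is the local ring of a closed point of the curve with function field `F / k`. -/
def IsPlace {F : Type*} [Field F] [Algebra k F] (O : ValuationSubring F) : Prop :=
  (∀ c : k, algebraMap k F c ∈ O) ∧ O ≠ ⊤

/-- The stalk at `O` of the sheaf `Ω_X`, inside the module `Ω[F⁄k]` of rational differentials:
the `O`-submodule generated by the differentials `da`, `a ∈ O`. -/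
def regularDifferentialsAt {F : Type*} [Field F] [Algebra k F] (O : ValuationSubring F) :
    AddSubgroup Ω[F⁄k] :=
  AddSubgroup.closure {η | ∃ c ∈ O, ∃ a ∈ O, η = c • KaehlerDifferential.D k F a}

/-- The stalk at `O` of `Ω_X^{⊗n}`, inside the `n`-th tensor power over `F` of `Ω[F⁄k]`
(the degree `n` part of the tensor algebra): the `O`-submodule generated by the
`da₁ ⊗ ⋯ ⊗ daₙ`, `aᵢ ∈ O`. -/
def regularPolydifferentialsAt {F : Type*} [Field F] [Algebra k F] (n : ℕ)
    (O : ValuationSubring F) : AddSubgroup (TensorAlgebra F Ω[F⁄k]) :=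
  AddSubgroup.closure {η | ∃ c ∈ O, ∃ a : Fin n → F, (∀ i, a i ∈ O) ∧
    η = c • TensorAlgebra.tprod F Ω[F⁄k] n (fun i => KaehlerDifferential.D k F (a i))}

variable {k F}

theorem smul_mem_regularDifferentialsAt {O : ValuationSubring F} {c : F} (hc : c ∈ O)
    {η : Ω[F⁄k]} (hη : η ∈ regularDifferentialsAt k O) :
    c • η ∈ regularDifferentialsAt k O := by
  unfold regularDifferentialsAt at hη ⊢
  induction hη using AddSubgroup.closure_induction with
  | mem x hx =>
    obtain ⟨d, hd, a, ha, rfl⟩ := hx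
    exact AddSubgroup.subset_closure ⟨c * d, O.mul_mem _ _ hc hd, a, ha, by rw [mul_smul]⟩
  | zero => simp
  | add x y _ _ hx hy => rw [smul_add]; exact add_mem hx hy
  | neg x _ hx => rw [smul_neg]; exact neg_mem hx

theorem smul_mem_regularPolydifferentialsAt {n : ℕ} {O : ValuationSubring F} {c : F} (hc : c ∈ O)
    {η : TensorAlgebra F Ω[F⁄k]} (hη : η ∈ regularPolydifferentialsAt k n O) :
    c • η ∈ regularPolydifferentialsAt k n O := by
  unfold regularPolydifferentialsAt at hη ⊢
  induction hη using AddSubgroup.closure_induction with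
  | mem x hx =>
    obtain ⟨d, hd, a, ha, rfl⟩ := hx
    exact AddSubgroup.subset_closure ⟨c * d, O.mul_mem _ _ hc hd, a, ha, by rw [mul_smul]⟩
  | zero => simp
  | add x y _ _ hx hy => rw [smul_add]; exact add_mem hx hy
  | neg x _ hx => rw [smul_neg]; exact neg_mem hx

theorem ι_mem_regularPolydifferentialsAt {O : ValuationSubring F}
    {η : Ω[F⁄k]} (hη : η ∈ regularDifferentialsAt k O) :
    TensorAlgebra.ι F η ∈ regularPolydifferentialsAt k 1 O := by
  unfold regularDifferentialsAt at hη
  unfold regularPolydifferentialsAt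
  induction hη using AddSubgroup.closure_induction with
  | mem x hx =>
    obtain ⟨d, hd, a, ha, rfl⟩ := hx
    exact AddSubgroup.subset_closure ⟨d, hd, fun _ => a, fun _ => ha, by simp⟩
  | zero => simp
  | add x y _ _ hx hy => rw [map_add]; exact add_mem hx hy
  | neg x _ hx => rw [map_neg]; exact neg_mem hx

theorem one_mem_regularPolydifferentialsAt (O : ValuationSubring F) :
    (1 : TensorAlgebra F Ω[F⁄k]) ∈ regularPolydifferentialsAt k 0 O :=
  AddSubgroup.subset_closure ⟨1, O.one_mem, Fin.elim0, fun i => i.elim0, by simp⟩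

theorem mul_mem_regularPolydifferentialsAt {m n : ℕ} {O : ValuationSubring F}
    {η θ : TensorAlgebra F Ω[F⁄k]} (hη : η ∈ regularPolydifferentialsAt k m O)
    (hθ : θ ∈ regularPolydifferentialsAt k n O) :
    η * θ ∈ regularPolydifferentialsAt k (m + n) O := by
  unfold regularPolydifferentialsAt at hη hθ ⊢
  induction hη using AddSubgroup.closure_induction with
  | zero => simp
  | add x y _ _ hx hy => rw [add_mul]; exact add_mem hx hy
  | neg x _ hx => rw [neg_mul]; exact neg_mem hx
  | mem x hx =>
    obtain ⟨c, hc, a, ha, rfl⟩ := hx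
    induction hθ using AddSubgroup.closure_induction with
    | zero => simp
    | add x y _ _ hx hy => rw [mul_add]; exact add_mem hx hy
    | neg x _ hx => rw [mul_neg]; exact neg_mem hx
    | mem y hy =>
      obtain ⟨d, hd, b, hb, rfl⟩ := hy
      refine AddSubgroup.subset_closure
        ⟨c * d, O.mul_mem _ _ hc hd, Fin.append a b, fun i => ?_, ?_⟩
      · refine Fin.addCases (fun i => ?_) (fun i => ?_) i
        · simpa using ha i
        · simpa using hb i
      · have : (fun i => TensorAlgebra.ι F (KaehlerDifferential.D k F (Fin.append a b i)))
            = Fin.append (fun i => TensorAlgebra.ι F (KaehlerDifferential.D k F (a i)))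
                (fun i => TensorAlgebra.ι F (KaehlerDifferential.D k F (b i))) := by
          funext i
          refine Fin.addCases (fun i => ?_) (fun i => ?_) i <;> simp
        rw [TensorAlgebra.tprod_apply, TensorAlgebra.tprod_apply, TensorAlgebra.tprod_apply, this,
          List.ofFn_fin_append, List.prod_append, smul_mul_smul_comm]

variable (k F)

/-- `H⁰(X, Ω_X)`: the rational differentials that are regular at every point. -/
def holomorphicDifferentials : Submodule k Ω[F⁄k] where
  carrier := {η | ∀ O : ValuationSubring F, IsPlace k O → η ∈ regularDifferentialsAt k O}
  zero_mem' := fun _ _ => zero_mem _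
  add_mem' := fun hx hy O hO => add_mem (hx O hO) (hy O hO)
  smul_mem' := fun c x hx O hO => by
    rw [← algebraMap_smul F c x]
    exact smul_mem_regularDifferentialsAt (hO.1 c) (hx O hO)

/-- `H⁰(X, Ω_X^{⊗n})`: the rational `n`-differentials that are regular at every point. -/
def holomorphicPolydifferentials (n : ℕ) : Submodule k (TensorAlgebra F Ω[F⁄k]) where
  carrier := {η | η ∈ LinearMap.range (TensorAlgebra.ι F : Ω[F⁄k] →ₗ[F] _) ^ n ∧
    ∀ O : ValuationSubring F, IsPlace k O → η ∈ regularPolydifferentialsAt k n O}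
  zero_mem' := ⟨zero_mem _, fun _ _ => zero_mem _⟩
  add_mem' := fun hx hy => ⟨add_mem hx.1 hy.1, fun O hO => add_mem (hx.2 O hO) (hy.2 O hO)⟩
  smul_mem' := fun c x hx => by
    rw [← algebraMap_smul F c x]
    exact ⟨Submodule.smul_mem _ _ hx.1,
      fun O hO => smul_mem_regularPolydifferentialsAt (hO.1 c) (hx.2 O hO)⟩

instance : SetLike.GradedMonoid (holomorphicPolydifferentials k F) where
  one_mem := ⟨by rw [pow_zero]; exact Submodule.one_le.mp le_rfl,
    fun O _ => one_mem_regularPolydifferentialsAt O⟩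
  mul_mem := fun _ _ _ _ hx hy => ⟨by rw [pow_add]; exact Submodule.mul_mem_mul hx.1 hy.1,
    fun O hO => mul_mem_regularPolydifferentialsAt (hx.2 O hO) (hy.2 O hO)⟩

/-- The genus `g = dim_k H⁰(X, Ω_X)`. -/
def genus : ℕ := Module.finrank k (holomorphicDifferentials k F)

/-- The identification of a holomorphic differential with a tensor of degree one. -/
def toPolydifferentials :
    holomorphicDifferentials k F →ₗ[k] holomorphicPolydifferentials k F 1 where
  toFun η := ⟨TensorAlgebra.ι F (η : Ω[F⁄k]),
    by rw [pow_one]; exact LinearMap.mem_range_self _ _,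
    fun O hO => ι_mem_regularPolydifferentialsAt (η.2 O hO)⟩
  map_add' x y := Subtype.ext (by simp)
  map_smul' c x := Subtype.ext (by
    simp only [Submodule.coe_smul, RingHom.id_apply]
    rw [← algebraMap_smul F c (x : Ω[F⁄k]), map_smul, algebraMap_smul])

variable {k F}

/-- If `Ω[F⁄k]` has rank at most one, then its tensor algebra is commutative. -/
theorem tensorAlgebra_mul_comm (h : Module.rank F Ω[F⁄k] ≤ 1)
    (x y : TensorAlgebra F Ω[F⁄k]) : x * y = y * x := by
  obtain ⟨w, hw⟩ := rank_le_one_iff.mp h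
  change Commute x y
  induction y using TensorAlgebra.induction with
  | algebraMap r => exact Algebra.commute_algebraMap_right _ _
  | mul a b ha hb => exact ha.mul_right hb
  | add a b ha hb => exact ha.add_right hb
  | ι v =>
    induction x using TensorAlgebra.induction with
    | algebraMap r => exact Algebra.commute_algebraMap_left _ _
    | mul a b ha hb => exact ha.mul_left hb
    | add a b ha hb => exact ha.add_left hb
    | ι u =>
      obtain ⟨a, rfl⟩ := hw u
      obtain ⟨b, rfl⟩ := hw v
      rw [map_smul, map_smul]
      exact ((Commute.refl _).smul_left a).smul_right b

theorem directSum_mul_comm (h : Module.rank F Ω[F⁄k] ≤ 1)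
    (x y : ⨁ n, holomorphicPolydifferentials k F n) : x * y = y * x := by
  change Commute x y
  induction x using DirectSum.induction_on with
  | zero => exact Commute.zero_left _
  | add a b ha hb => exact ha.add_left hb
  | of i a =>
    induction y using DirectSum.induction_on with
    | zero => exact Commute.zero_right _
    | add a b ha hb => exact ha.add_right hb
    | of j b =>
      change _ * _ = _ * _
      rw [DirectSum.of_mul_of, DirectSum.of_mul_of]
      exact DirectSum.of_eq_of_gradedMonoid_eq
        (Sigma.subtype_ext (add_comm i j) (tensorAlgebra_mul_comm h a b))

/-- The canonical map `Sym H⁰(X, Ω_X) → ⨁ₙ H⁰(X, Ω_X^{⊗n})`, i.e. the homomorphism of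
`k`-algebras that is the identity in degree one.  (Since `F` is the function field of a curve,
`Ω[F⁄k]` is one-dimensional; this makes the target commutative.) -/
def canonicalMap (h : Module.rank F Ω[F⁄k] ≤ 1) :
    SymmetricAlgebra k (holomorphicDifferentials k F) →ₐ[k]
      ⨁ n, holomorphicPolydifferentials k F n :=
  letI : CommSemiring (⨁ n, holomorphicPolydifferentials k F n) :=
    { (inferInstance : Semiring (⨁ n, holomorphicPolydifferentials k F n)) with
      mul_comm := directSum_mul_comm h }
  SymmetricAlgebra.lift
    ((DirectSum.lof k ℕ (fun n => holomorphicPolydifferentials k F n) 1).comp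
      (toPolydifferentials k F))

theorem canonicalMap_ι (h : Module.rank F Ω[F⁄k] ≤ 1) (η : holomorphicDifferentials k F) :
    canonicalMap h (SymmetricAlgebra.ι k _ η) =
      DirectSum.of (fun n => holomorphicPolydifferentials k F n) 1
        (toPolydifferentials k F η) := by
  let _ : CommSemiring (⨁ n, holomorphicPolydifferentials k F n) :=
    { (inferInstance : Semiring (⨁ n, holomorphicPolydifferentials k F n)) with
      mul_comm := directSum_mul_comm h }
  exact SymmetricAlgebra.lift_ι_apply _ η

/-- The canonical ideal of the curve: the kernel of the canonical map. -/
def canonicalIdeal (h : Module.rank F Ω[F⁄k] ≤ 1) :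
    Ideal (SymmetricAlgebra k (holomorphicDifferentials k F)) :=
  RingHom.ker (canonicalMap h)

/-- The pole order at `P` of a function: the least `n` with `𝔪_P ^ n • a ⊆ O_P`. -/
def poleOrder (P : ValuationSubring F) (a : F) : ℕ :=
  sInf {n | ∀ t ∈ IsLocalRing.maximalIdeal P ^ n, (t : F) * a ∈ P}

/-- The place `O` has ramification index `e` over the subfield `E`, i.e. `𝔪_Q O = 𝔪_O ^ e`, where
`Q = O ∩ E` is the place of `E` below `O`, so that `𝔪_Q = 𝔪_O ∩ E`. -/
def HasRamificationIndex (E : IntermediateField k F) (O : ValuationSubring F) (e : ℕ) : Prop :=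
  Ideal.span {a : O | (a : F) ∈ E ∧ a ∈ IsLocalRing.maximalIdeal O} =
    IsLocalRing.maximalIdeal O ^ e

end Curve

/-! ### Harbater–Katz–Gabber covers -/

section Cover

variable {k F : Type*} [Field k] [Field F] [Algebra k F] {r : ℕ}

/-- The functions `f₀, …, f_r` generate the function field of an HKG-cover `X → ℙ¹` with Galois
group a `p`-group, ramified at `P` only.  The line `ℙ¹` has function field `k(f₀)`, and
`F_{i+1} = F_i(f_i)` is the tower of intermediate fields, from `F₁ = k(f₀)` up to
`F_{r+1} = F`. -/
structure IsHKGCover (p : ℕ) (P : ValuationSubring F) (f : Fin (r + 1) → F) : Prop where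
  isPlace : IsPlace k P
  transcendental : Transcendental k (f 0)
  finite : FiniteDimensional k⟮f 0⟯ F
  isGalois : IsGalois k⟮f 0⟯ F
  isPGroup : IsPGroup p Gal(F/k⟮f 0⟯)
  /-- `P` is totally ramified over `ℙ¹`. -/
  totally_ramified : HasRamificationIndex k⟮f 0⟯ P (Module.finrank k⟮f 0⟯ F)
  /-- All other points are unramified over `ℙ¹`. -/
  unramified : ∀ O : ValuationSubring F, IsPlace k O → O ≠ P →
    HasRamificationIndex k⟮f 0⟯ O 1
  /-- The `f_i` have no pole outside `P`. -/
  regular : ∀ i, ∀ O : ValuationSubring F, IsPlace k O → O ≠ P → f i ∈ O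
  adjoin_eq_top : IntermediateField.adjoin k (Set.range f) = ⊤

/-- The differentials of the function field of an HKG-cover are one-dimensional. -/
theorem IsHKGCover.rank_le_one {p : ℕ} {P : ValuationSubring F} {f : Fin (r + 1) → F}
    (hX : IsHKGCover (k := k) p P f) : Module.rank F Ω[F⁄k] ≤ 1 := by
  have := hX.isGalois
  set W : Submodule F Ω[F⁄k] := F ∙ KaehlerDifferential.D k F (f 0)
  let d : Derivation k F (Ω[F⁄k] ⧸ W) := W.mkQ.compDer (KaehlerDifferential.D k F)
  have hd0 : ∀ e ∈ k⟮f 0⟯, d e = 0 := by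
    intro e he
    induction he using IntermediateField.adjoin_induction with
    | mem x hx =>
      obtain rfl : x = f 0 := hx
      exact (Submodule.Quotient.mk_eq_zero W).mpr (Submodule.mem_span_singleton_self _)
    | algebraMap c => exact d.map_algebraMap c
    | add x y _ _ hx hy => rw [map_add, hx, hy, add_zero]
    | mul x y _ _ hx hy => rw [d.leibniz, hx, hy, smul_zero, smul_zero, add_zero]
    | inv x _ hx =>
      rw [Derivation.leibniz_inv, hx, smul_zero]
  let d' : Derivation k⟮f 0⟯ F (Ω[F⁄k] ⧸ W) :=
    { toFun := d
      map_add' := d.map_add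
      map_smul' := fun c x => by
        rw [Algebra.smul_def, d.leibniz, show d (algebraMap k⟮f 0⟯ F c) = 0 from hd0 _ c.2, smul_zero, add_zero, RingHom.id_apply,
          algebraMap_smul]
      map_one_eq_zero' := d.map_one_eq_zero
      leibniz' := d.leibniz }
  have : Algebra.FormallyUnramified k⟮f 0⟯ F := Algebra.FormallyUnramified.of_isSeparable _ _
  have hd' : d' = 0 := by
    rw [← d'.liftKaehlerDifferential_comp,
      Subsingleton.elim d'.liftKaehlerDifferential 0]
    ext
    simp
  have hW : ∀ η : Ω[F⁄k], η ∈ W := by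
    intro η
    have hη : η ∈ Submodule.span F (Set.range (KaehlerDifferential.D k F)) := by
      rw [KaehlerDifferential.span_range_derivation]; trivial
    refine Submodule.span_le.mpr ?_ hη
    rintro _ ⟨x, rfl⟩
    exact (Submodule.Quotient.mk_eq_zero W).mp (congrArg (fun D => D x) hd')
  exact rank_le_one_iff.mpr ⟨_, fun η => Submodule.mem_span_singleton.mp (hW η)⟩

/-- `‖L‖ = i₀ |G₀| + ∑_ν i_ν m̄_ν`, where `G₀` is the inertia group at `P`, which is the whole
Galois group, and `m̄_ν` is the pole order of `f_ν` at `P`. -/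
def norm (k : Type*) {F : Type*} [Field k] [Field F] [Algebra k F]
    (P : ValuationSubring F) (f : Fin (r + 1) → F) (L : Fin (r + 1) → ℕ) : ℕ :=
  L 0 * Nat.card Gal(F/k⟮f 0⟯) + ∑ ν : Fin r, L ν.succ * poleOrder P (f ν.succ)

/-- The set `𝐀` of all `L ∈ ℕ^{r+1}` with `‖L‖ ≤ 2g - 2`. -/
def indexSet (k : Type*) {F : Type*} [Field k] [Field F] [Algebra k F]
    (P : ValuationSubring F) (f : Fin (r + 1) → F) : Set (Fin (r + 1) → ℕ) :=
  {L | (norm k P f L : ℤ) ≤ 2 * (genus k F : ℤ) - 2}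

/-- `ω_L = f_L df₀`, where `f_L = f₀^{i₀} ⋯ f_r^{i_r}`. -/
def omega (k : Type*) {F : Type*} [Field k] [Field F] [Algebra k F]
    (f : Fin (r + 1) → F) (L : Fin (r + 1) → ℕ) : Ω[F⁄k] :=
  (∏ i, f i ^ L i) • KaehlerDifferential.D k F (f 0)

/-- The set `G₀` of binomials `ω_L ω_K - ω_{L'} ω_{K'}` in `Sym H⁰(X, Ω_X)` with
`L + K = L' + K'` and `L, K, L', K' ∈ 𝐀`, the `ω_L` being holomorphic by `h`. -/
def binomials {P : ValuationSubring F} {f : Fin (r + 1) → F}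
    (h : ∀ L ∈ indexSet k P f, omega k f L ∈ holomorphicDifferentials k F) :
    Set (SymmetricAlgebra k (holomorphicDifferentials k F)) :=
  {b | ∃ L K L' K' : indexSet k P f, (L + K : Fin (r + 1) → ℕ) = L' + K' ∧
    b = SymmetricAlgebra.ι k _ ⟨omega k f L, h L L.2⟩ * SymmetricAlgebra.ι k _ ⟨omega k f K, h K K.2⟩
      - SymmetricAlgebra.ι k _ ⟨omega k f L', h L' L'.2⟩ *
        SymmetricAlgebra.ι k _ ⟨omega k f K', h K' K'.2⟩}

end Cover

end HKG

end

/-!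
Write a differential as `w df₀` and let `π` be a uniformizer at `P`. Since `df₀` generates the
regular differentials away from `P`, the holomorphic differentials are the `w df₀` with `w` regular
outside `P` of pole order at most `d` at `P`, where `d` is the pole order of `dπ / df₀`. No
`w df₀` with `w` regular outside `P` has exactly a simple pole at `P`: by Euler's formula the
trace of `w` to `k(f₀)` would be a nonzero function without poles that vanishes at `P`. Hence no two
pole orders of functions regular outside `P` add up to `d + 1`, so at most half of the `d + 2`
numbers `0, …, d + 1` are pole orders, and `2 g - 2 ≤ d`. A function `f_L` of pole order at most
`2 g - 2` thus makes `f_L df₀` holomorphic, and the binomials lie in the canonical ideal because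
`f_L f_K = f_{L'} f_{K'}`.
-/

noncomputable section

namespace HKG

open IsLocalRing

/-! ### Valuation rings and integrality -/

section Integral

variable {k F : Type*} [Field k] [Field F] [Algebra k F]

theorem mem_of_mem_adjoin {S : Set F} {O : ValuationSubring F}
    (hk : ∀ c : k, algebraMap k F c ∈ O) (hS : ∀ s ∈ S, s ∈ O) {a : F}
    (ha : a ∈ Algebra.adjoin k S) : a ∈ O := by
  induction ha using Algebra.adjoin_induction with
  | mem x hx => exact hS x hx
  | algebraMap c => exact hk c
  | add x y _ _ hx hy => exact add_mem hx hy
  | mul x y _ _ hx hy => exact mul_mem hx hy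

theorem mem_of_isIntegral_adjoin {S : Set F} {O : ValuationSubring F}
    (hk : ∀ c : k, algebraMap k F c ∈ O) (hS : ∀ s ∈ S, s ∈ O) {w : F}
    (hw : IsIntegral (Algebra.adjoin k S) w) : w ∈ O := by
  let i : Algebra.adjoin k S →+* O :=
    (Algebra.adjoin k S).val.toRingHom.codRestrict O.toSubring fun a => mem_of_mem_adjoin hk hS a.2
  obtain ⟨q, hq, hq0⟩ := hw
  have hwO : IsIntegral O w := ⟨q.map i, hq.map i, by rw [Polynomial.eval₂_map]; exact hq0⟩
  obtain ⟨c, rfl⟩ := IsIntegrallyClosed.isIntegral_iff.mp hwO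
  exact c.2

theorem isIntegral_adjoin_of_forall_mem {S : Set F} {w : F}
    (h : ∀ O : ValuationSubring F, (∀ c : k, algebraMap k F c ∈ O) → (∀ s ∈ S, s ∈ O) → w ∈ O) :
    IsIntegral (Algebra.adjoin k S) w := by
  have hw : w ∈ (integralClosure
      (Subring.closure (Set.range (algebraMap k F) ∪ S)) F).toSubring := by
    rw [← iInf_valuationSubring_superset, Subring.mem_iInf]
    rintro ⟨O, hO⟩
    exact h O (fun c => hO (Or.inl ⟨c, rfl⟩)) fun s hs => hO (Or.inr hs)
  obtain ⟨q, hq, hq0⟩ := (hw : IsIntegral _ w)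
  let i : Subring.closure (Set.range (algebraMap k F) ∪ S) →+* Algebra.adjoin k S :=
    Subring.inclusion (T := (Algebra.adjoin k S).toSubring)
      (Algebra.adjoin_eq_ring_closure (R := k) S).ge
  exact ⟨q.map i, hq.map i, by rw [Polynomial.eval₂_map]; exact hq0⟩

theorem isIntegral_of_forall_isPlace_mem {w : F}
    (h : ∀ O : ValuationSubring F, IsPlace k O → w ∈ O) : IsIntegral k w := by
  have hw : IsIntegral (Algebra.adjoin k (∅ : Set F)) w :=
    isIntegral_adjoin_of_forall_mem fun O hO _ => by
      by_cases htop : O = ⊤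
      · exact htop ▸ ValuationSubring.mem_top w
      · exact h O ⟨hO, htop⟩
  have : Algebra.IsIntegral k (Algebra.adjoin k (∅ : Set F)) := by
    rw [Algebra.adjoin_empty]
    exact .of_surjective (Algebra.ofId k _) fun a => by
      obtain ⟨c, hc⟩ := Algebra.mem_bot.mp a.2
      exact ⟨c, Subtype.ext hc⟩
  exact isIntegral_trans w hw

end Integral

section LocalRing

variable {k B R F : Type*} [Field k] [CommRing B] [CommRing R] [IsLocalRing R] [Field F]

theorem under_maximalIdeal_ne_bot [IsDomain B] [Algebra B F] [IsFractionRing B F]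
    {O : ValuationSubring F} [Algebra B O] [IsScalarTower B O F] (hO : O ≠ ⊤) :
    (maximalIdeal O).under B ≠ ⊥ := by
  contrapose! hO
  have hunit (s : B) (hs : s ≠ 0) : IsUnit (algebraMap B O s) := by
    by_contra h
    exact hs (Ideal.mem_bot.mp (hO ▸ Ideal.mem_comap.mpr ((mem_maximalIdeal _).mpr h)))
  refine eq_top_iff.mpr fun z _ => ?_
  obtain ⟨b, s, hs, rfl⟩ := IsFractionRing.div_surjective (A := B) z
  obtain ⟨u, hu⟩ := hunit s (nonZeroDivisors.ne_zero hs)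
  have hu' : (algebraMap B F s)⁻¹ = ((u⁻¹ : Oˣ) : O) := by
    refine inv_eq_of_mul_eq_one_right ?_
    rw [IsScalarTower.algebraMap_apply B O F, ← hu]
    exact congrArg Subtype.val u.mul_inv
  rw [div_eq_mul_inv, hu', IsScalarTower.algebraMap_apply B O F]
  exact mul_mem (algebraMap B O b).2 ((u⁻¹ : Oˣ) : O).2

theorem isLocalization_under_maximalIdeal [IsDedekindDomain B] [Algebra B F]
    [IsFractionRing B F] {O : ValuationSubring F} [Algebra B O] [IsScalarTower B O F]
    (hO : O ≠ ⊤) : IsLocalization.AtPrime O ((maximalIdeal O).under B) := by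
  set 𝔭 := (maximalIdeal O).under B
  let B' := Localization.AtPrime 𝔭
  have : IsDiscreteValuationRing B' :=
    IsLocalization.AtPrime.isDiscreteValuationRing_of_dedekind_domain B
      (under_maximalIdeal_ne_bot hO) B'
  have hunit (s : 𝔭.primeCompl) : IsUnit (algebraMap B O s) := by
    by_contra h
    exact s.2 (Ideal.mem_comap.mpr ((mem_maximalIdeal _).mpr h))
  let f : B' →+* O := IsLocalization.lift hunit
  have hf (b : B) : f (algebraMap B B' b) = algebraMap B O b := IsLocalization.lift_eq hunit b
  have : IsLocalHom f := ⟨fun y hy => by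
    obtain ⟨⟨b, s⟩, hbs⟩ := IsLocalization.surj 𝔭.primeCompl y
    have hb : b ∉ 𝔭 := fun hb => by
      refine (mem_maximalIdeal _).mp (Ideal.mem_comap.mp hb) ?_
      rw [← hf, ← hbs, map_mul, hf]
      exact hy.mul (hunit s)
    exact isUnit_of_mul_isUnit_left (hbs ▸ IsLocalization.map_units B' (⟨b, hb⟩ : 𝔭.primeCompl))⟩
  let _ : Algebra B' F := ((algebraMap O F).comp f).toAlgebra
  have : IsScalarTower B B' F := .of_algebraMap_eq fun b => by
    rw [RingHom.algebraMap_toAlgebra, RingHom.comp_apply, hf, ← IsScalarTower.algebraMap_apply]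
  have : IsFractionRing B' F :=
    IsFractionRing.isFractionRing_of_isDomain_of_isLocalization 𝔭.primeCompl B' F
  have hbij := bijective_rangeRestrict_comp_of_valuationRing f (algebraMap O F) rfl
  have hinj : Function.Injective (algebraMap O F).rangeRestrict := fun _ _ h =>
    FaithfulSMul.algebraMap_injective O F
      (congrArg (algebraMap O F).range.subtype h)
  have hf_bij : Function.Bijective f :=
    ⟨.of_comp (f := (algebraMap O F).rangeRestrict) hbij.injective,
      .of_comp_left (f := (algebraMap O F).rangeRestrict) hbij.surjective hinj⟩
  exact IsLocalization.isLocalization_of_algEquiv 𝔭.primeCompl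
    (AlgEquiv.ofBijective (AlgHom.mk f hf) hf_bij)

theorem exists_sub_algebraMap_mem_maximalIdeal [IsAlgClosed k] [Algebra k B]
    [Algebra.FiniteType k B] [Algebra k R] [Algebra B R] [IsScalarTower k B R] (𝔭 : Ideal B)
    [𝔭.IsMaximal] [IsLocalization.AtPrime R 𝔭] (a : R) :
    ∃ c : k, a - algebraMap k R c ∈ maximalIdeal R := by
  let _ : Field (B ⧸ 𝔭) := Ideal.Quotient.field 𝔭
  have : Algebra.FiniteType k (B ⧸ 𝔭) :=
    .of_surjective (Ideal.Quotient.mkₐ k 𝔭) (Ideal.Quotient.mkₐ_surjective k 𝔭)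
  have : Module.Finite k (B ⧸ 𝔭) := finite_of_finite_type_of_isJacobsonRing k _
  obtain ⟨b, hb⟩ := (IsLocalization.AtPrime.equivQuotMaximalIdeal 𝔭 R).surjective
    (Ideal.Quotient.mk _ a)
  obtain ⟨c, rfl⟩ := (IsAlgClosed.algebraMap_bijective_of_isIntegral (k := k)).2 b
  refine ⟨c, Ideal.Quotient.eq.mp ?_⟩
  rw [← hb, IsScalarTower.algebraMap_apply k B R]
  rfl

theorem span_D_eq_top_of_maximalIdeal_eq_span [Algebra k R] [Algebra.EssFiniteType k R]
    (hres : ∀ a : R, ∃ c : k, a - algebraMap k R c ∈ maximalIdeal R) {π : R}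
    (hπ : maximalIdeal R = Ideal.span {π}) :
    Submodule.span R {KaehlerDifferential.D k R π} = ⊤ := by
  refine top_le_iff.mp (Submodule.le_of_le_smul_of_le_jacobson_bot Module.Finite.fg_top
    (maximalIdeal_le_jacobson ⊥) ?_)
  rw [← KaehlerDifferential.span_range_derivation, Submodule.span_le]
  rintro _ ⟨a, rfl⟩
  obtain ⟨c, hc⟩ := hres a
  obtain ⟨b, hb⟩ := Ideal.mem_span_singleton.mp (hπ ▸ hc)
  have hDa : KaehlerDifferential.D k R a =
      b • KaehlerDifferential.D k R π + π • KaehlerDifferential.D k R b := by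
    rw [eq_add_of_sub_eq hb, map_add, Derivation.map_algebraMap, add_zero, Derivation.leibniz,
      add_comm]
  rw [hDa]
  exact add_mem
    (Submodule.mem_sup_left (Submodule.smul_mem _ _ (Submodule.mem_span_singleton_self _)))
    (Submodule.mem_sup_right (Submodule.smul_mem_smul
      (hπ ▸ Ideal.mem_span_singleton_self π) (Submodule.subset_span ⟨b, rfl⟩)))

end LocalRing

/-! ### Uniformizers -/

section Uniformizer

variable {K Γ₀ : Type*} [Field K] [LinearOrderedCommGroupWithZero Γ₀]

/-- `π` is a uniformizer of the discrete valuation `v`: its value lies below `1` and generates the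
value group of `v`. -/
structure IsUniformizer (v : Valuation K Γ₀) (π : K) : Prop where
  ne_zero : π ≠ 0
  lt_one : v π < 1
  exists_zpow : ∀ w : K, w ≠ 0 → ∃ n : ℤ, v w = v π ^ n

namespace IsUniformizer

variable {v : Valuation K Γ₀} {π : K}

theorem pos (h : IsUniformizer v π) : 0 < v π :=
  zero_lt_iff.mpr (v.ne_zero_iff.mpr h.ne_zero)

theorem zpow_le_iff (h : IsUniformizer v π) {m n : ℤ} : v π ^ m ≤ v π ^ n ↔ n ≤ m :=
  zpow_le_zpow_iff_right_of_lt_one₀ h.pos h.lt_one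

theorem zpow_lt_iff (h : IsUniformizer v π) {m n : ℤ} : v π ^ m < v π ^ n ↔ n < m :=
  zpow_lt_zpow_iff_right_of_lt_one₀ h.pos h.lt_one

theorem zpow_inj (h : IsUniformizer v π) {m n : ℤ} : v π ^ m = v π ^ n ↔ m = n :=
  zpow_right_inj₀ h.pos h.lt_one.ne

theorem valuation_le_zpow_of_lt (h : IsUniformizer v π) {a : K} {n : ℤ} (ha : v a < v π ^ n) :
    v a ≤ v π ^ (n + 1) := by
  rcases eq_or_ne a 0 with rfl | ha0
  · simp
  · obtain ⟨m, hm⟩ := h.exists_zpow a ha0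
    rw [hm, h.zpow_lt_iff] at ha
    rw [hm, h.zpow_le_iff]
    omega

theorem valuation_le_of_lt_one (h : IsUniformizer v π) {a : K} (ha : v a < 1) : v a ≤ v π := by
  simpa using h.valuation_le_zpow_of_lt (n := 0) (by simpa using ha)

end IsUniformizer

variable {O : ValuationSubring K} {π : K}

theorem exists_isUniformizer (O : ValuationSubring K) [IsDiscreteValuationRing O] :
    ∃ π, IsUniformizer O.valuation π := by
  obtain ⟨π, hπ⟩ := IsDiscreteValuationRing.exists_irreducible O
  have hO : ∀ a ∈ O, a ≠ 0 → ∃ n : ℕ, O.valuation a = O.valuation (π : K) ^ n := by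
    intro a ha ha0
    obtain ⟨n, u, hu⟩ := IsDiscreteValuationRing.associated_pow_irreducible
      (x := (⟨a, ha⟩ : O)) (fun h => ha0 (congrArg Subtype.val h)) hπ
    exact ⟨n, by simpa using congrArg (fun b : O => O.valuation (b : K)) hu⟩
  refine ⟨π, by simpa using hπ.ne_zero, ?_, fun w hw => ?_⟩
  · exact (O.valuation_lt_one_iff π).mp ((mem_maximalIdeal π).mpr hπ.not_isUnit)
  · rcases O.mem_or_inv_mem w with h | h
    · obtain ⟨n, hn⟩ := hO w h hw
      exact ⟨n, by rw [zpow_natCast, hn]⟩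
    · obtain ⟨n, hn⟩ := hO _ h (inv_ne_zero hw)
      exact ⟨-n, by rw [zpow_neg, zpow_natCast, ← hn, map_inv₀, inv_inv]⟩

namespace IsUniformizer

theorem mem (h : IsUniformizer O.valuation π) : π ∈ O :=
  (O.valuation_le_one_iff π).mp h.lt_one.le

theorem mem_span_singleton_pow_iff (h : IsUniformizer O.valuation π) (n : ℕ) (a : O) :
    a ∈ Ideal.span {(⟨π, h.mem⟩ : O)} ^ n ↔ O.valuation (a : K) ≤ O.valuation π ^ n := by
  rw [Ideal.span_singleton_pow, Ideal.mem_span_singleton, ← map_pow, O.valuation_le_iff]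
  constructor
  · rintro ⟨c, rfl⟩
    exact ⟨c, mul_comm _ _⟩
  · rintro ⟨c, hc⟩
    exact ⟨c, Subtype.ext (by rw [← hc, mul_comm]; rfl)⟩

theorem maximalIdeal_eq_span (h : IsUniformizer O.valuation π) :
    maximalIdeal O = Ideal.span {⟨π, h.mem⟩} := by
  ext b
  have hb := h.mem_span_singleton_pow_iff 1 b
  rw [pow_one, pow_one] at hb
  rw [O.valuation_lt_one_iff, hb]
  exact ⟨h.valuation_le_of_lt_one, fun hb => hb.trans_lt h.lt_one⟩

theorem mem_maximalIdeal_pow_iff (h : IsUniformizer O.valuation π) (n : ℕ) (a : O) :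
    a ∈ maximalIdeal O ^ n ↔ O.valuation (a : K) ≤ O.valuation π ^ n := by
  rw [h.maximalIdeal_eq_span, h.mem_span_singleton_pow_iff]

theorem poleOrder_le_iff (h : IsUniformizer O.valuation π) {a : K} {n : ℕ} :
    poleOrder O a ≤ n ↔ O.valuation a ≤ O.valuation π ^ (-(n : ℤ)) := by
  have hiff (m : ℕ) : (∀ t ∈ maximalIdeal O ^ m, (t : K) * a ∈ O) ↔
      O.valuation a ≤ O.valuation π ^ (-(m : ℤ)) := by
    rw [zpow_neg, zpow_natCast, ← mul_one (O.valuation π ^ m)⁻¹,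
      le_inv_mul_iff₀ (pow_pos h.pos m)]
    constructor
    · intro H
      have := H (⟨π, h.mem⟩ ^ m) ((h.mem_maximalIdeal_pow_iff _ _).mpr (by simp))
      simpa [← O.valuation_le_one_iff] using this
    · intro H t ht
      rw [← O.valuation_le_one_iff, map_mul]
      exact (mul_le_mul_left ((h.mem_maximalIdeal_pow_iff _ _).mp ht) _).trans H
  have hne : {m | ∀ t ∈ maximalIdeal O ^ m, (t : K) * a ∈ O}.Nonempty := by
    rcases eq_or_ne a 0 with rfl | ha
    · exact ⟨0, (hiff 0).mpr (by simp)⟩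
    · obtain ⟨m, hm⟩ := h.exists_zpow a ha
      exact ⟨(-m).toNat, (hiff _).mpr (hm ▸ h.zpow_le_iff.mpr (by omega))⟩
  have hspec : O.valuation a ≤ O.valuation π ^ (-(poleOrder O a : ℤ)) :=
    (hiff _).mp (Nat.sInf_mem hne)
  exact ⟨fun hn => hspec.trans (h.zpow_le_iff.mpr (by omega)),
    fun hn => Nat.sInf_le ((hiff n).mpr hn)⟩

end IsUniformizer

end Uniformizer

/-! ### Smooth points -/

section Place

variable {k F : Type*} [Field k] [Field F] [Algebra k F]

variable (k) in
/-- The place `O` is a smooth `k`-rational point: `O` is a discrete valuation ring with residue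
field `k` whose differentials are generated by that of any uniformizer. -/
structure IsSmoothPlace (O : ValuationSubring F) : Prop where
  isDiscreteValuationRing : IsDiscreteValuationRing O
  exists_valuation_sub_lt_one : ∀ a ∈ O, ∃ c : k, O.valuation (a - algebraMap k F c) < 1
  exists_D_eq_smul : ∀ π, IsUniformizer O.valuation π → ∀ a ∈ O, ∃ c ∈ O,
    KaehlerDifferential.D k F a = c • KaehlerDifferential.D k F π

open IntermediateField.algebraAdjoinAdjoin in
theorem IsPlace.isSmoothPlace_of_mem [IsAlgClosed k] {O : ValuationSubring F} (hO : IsPlace k O)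
    {x : F} (hx : x ∈ O) (htr : Transcendental k x) [FiniteDimensional k⟮x⟯ F]
    [Algebra.IsSeparable k⟮x⟯ F] : IsSmoothPlace k O := by
  let A := Algebra.adjoin k {x}
  let e := Polynomial.algEquivOfTranscendental k x htr
  have : IsPrincipalIdealRing A := .of_surjective e.toRingEquiv.toRingHom e.surjective
  let B := integralClosure A F
  have : IsDedekindDomain B := integralClosure.isDedekindDomain A k⟮x⟯ F
  have : IsFractionRing B F := integralClosure.isFractionRing_of_finite_extension k⟮x⟯ F
  have : Module.Finite A B := IsIntegralClosure.finite A k⟮x⟯ F B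
  have : Algebra.FiniteType k A := .of_surjective e.toAlgHom e.surjective
  have : Algebra.FiniteType k B := .trans (S := A) inferInstance inferInstance
  let _ : Algebra k O := ((algebraMap k F).codRestrict O.toSubring hO.1).toAlgebra
  let _ : Algebra B O := ((algebraMap B F).codRestrict O.toSubring fun b =>
    mem_of_isIntegral_adjoin hO.1 (by rintro _ rfl; exact hx) b.2).toAlgebra
  have : IsScalarTower B O F := .of_algebraMap_eq fun _ => rfl
  have : IsScalarTower k O F := .of_algebraMap_eq fun _ => rfl
  have : IsScalarTower k B O := .of_algebraMap_eq fun _ => rfl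
  let 𝔭 := (maximalIdeal O).under B
  have hbot : 𝔭 ≠ ⊥ := under_maximalIdeal_ne_bot (F := F) hO.2
  have : IsLocalization.AtPrime O 𝔭 := isLocalization_under_maximalIdeal (F := F) hO.2
  have : 𝔭.IsMaximal := Ideal.IsPrime.isMaximal inferInstance hbot
  have hres := exists_sub_algebraMap_mem_maximalIdeal (k := k) (R := O) 𝔭
  have : Algebra.EssFiniteType B O := .of_isLocalization O 𝔭.primeCompl
  have : Algebra.EssFiniteType k O := .comp k B O
  refine ⟨IsLocalization.AtPrime.isDiscreteValuationRing_of_dedekind_domain B hbot O,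
    fun a ha => ?_, fun π hπ a ha => ?_⟩
  · obtain ⟨c, hc⟩ := hres ⟨a, ha⟩
    exact ⟨c, (O.valuation_lt_one_iff _).mp hc⟩
  · have hDa : KaehlerDifferential.D k O ⟨a, ha⟩ ∈
        Submodule.span O {KaehlerDifferential.D k O ⟨π, hπ.mem⟩} :=
      span_D_eq_top_of_maximalIdeal_eq_span hres hπ.maximalIdeal_eq_span ▸ Submodule.mem_top
    obtain ⟨c, hc⟩ := Submodule.mem_span_singleton.mp hDa
    have hmap := congrArg (KaehlerDifferential.map k k O F) hc
    rw [map_smul, KaehlerDifferential.map_D, KaehlerDifferential.map_D] at hmap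
    exact ⟨c, c.2, hmap.symm⟩

theorem adjoin_inv_singleton (x : F) : k⟮x⁻¹⟯ = k⟮x⟯ := by
  refine le_antisymm (IntermediateField.adjoin_simple_le_iff.mpr (inv_mem ?_))
    (IntermediateField.adjoin_simple_le_iff.mpr ?_)
  · exact IntermediateField.mem_adjoin_simple_self k x
  · simpa using inv_mem (IntermediateField.mem_adjoin_simple_self k x⁻¹)

theorem IsPlace.isSmoothPlace [IsAlgClosed k] {O : ValuationSubring F} (hO : IsPlace k O) {x : F}
    (htr : Transcendental k x) [FiniteDimensional k⟮x⟯ F] [Algebra.IsSeparable k⟮x⟯ F] :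
    IsSmoothPlace k O := by
  rcases O.mem_or_inv_mem x with hx | hx
  · exact hO.isSmoothPlace_of_mem hx htr
  · have : FiniteDimensional k⟮x⁻¹⟯ F := adjoin_inv_singleton (k := k) x ▸ inferInstance
    have : Algebra.IsSeparable k⟮x⁻¹⟯ F := adjoin_inv_singleton (k := k) x ▸ inferInstance
    exact hO.isSmoothPlace_of_mem hx (mt IsAlgebraic.inv_iff.mp htr)

end Place

section RationalFunctionField

open Polynomial

variable {k K Γ₀ : Type*} [Field k] [Field K] [Algebra k K] [LinearOrderedCommGroupWithZero Γ₀]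
  {v : Valuation K Γ₀} {y : K}

theorem valuation_algebraMap_eq_one (hk : ∀ c : k, v (algebraMap k K c) ≤ 1) {c : k}
    (hc : c ≠ 0) : v (algebraMap k K c) = 1 := by
  refine le_antisymm (hk c) ((inv_le_one₀ ?_).mp ?_)
  · exact zero_lt_iff.mpr (v.ne_zero_iff.mpr ((_root_.map_ne_zero _).mpr hc))
  · simpa using hk c⁻¹

theorem valuation_aeval_le_one (hk : ∀ c : k, v (algebraMap k K c) ≤ 1) (hy : v y ≤ 1) (q : k[X]) :
    v (aeval y q) ≤ 1 :=
  mem_of_mem_adjoin (O := v.valuationSubring) hk (by rintro _ rfl; exact hy)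
    (aeval_mem_adjoin_singleton k y)

theorem valuation_aeval_eq_one (hk : ∀ c : k, v (algebraMap k K c) ≤ 1) (hy : v y < 1) {q : k[X]}
    (hq : q.coeff 0 ≠ 0) : v (aeval y q) = 1 := by
  rw [← divX_mul_X_add q, map_add, map_mul, aeval_X, aeval_C, ← valuation_algebraMap_eq_one hk hq]
  refine v.map_add_eq_of_lt_right ?_
  rw [valuation_algebraMap_eq_one hk hq, map_mul]
  exact (mul_le_of_le_one_left' (valuation_aeval_le_one hk hy.le _)).trans_lt hy

theorem exists_eq_zpow_mul_aeval_div_aeval (hgen : k⟮y⟯ = ⊤) (hy0 : y ≠ 0) {a : K} (ha0 : a ≠ 0) :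
    ∃ n : ℤ, ∃ p q : k[X], p.coeff 0 ≠ 0 ∧ q.coeff 0 ≠ 0 ∧
      a = y ^ n * (aeval y p / aeval y q) := by
  have hX (p : k[X]) (hp : p ≠ 0) :
      ∃ n : ℕ, ∃ p' : k[X], p'.coeff 0 ≠ 0 ∧ aeval y p = y ^ n * aeval y p' := by
    obtain ⟨p', hp', hdvd⟩ := exists_eq_pow_rootMultiplicity_mul_and_not_dvd p hp 0
    rw [map_zero, sub_zero] at hp' hdvd
    refine ⟨p.rootMultiplicity 0, p', mt X_dvd_iff.mpr hdvd, ?_⟩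
    conv_lhs => rw [hp', map_mul, map_pow, aeval_X]
  obtain ⟨p, q, rfl⟩ := (IntermediateField.mem_adjoin_simple_iff k a).mp
    (hgen ▸ IntermediateField.mem_top : a ∈ k⟮y⟯)
  obtain ⟨m, p', hp', hp⟩ := hX p (by rintro rfl; simp at ha0)
  obtain ⟨n, q', hq', hq⟩ := hX q (by rintro rfl; simp at ha0)
  refine ⟨m - n, p', q', hp', hq', ?_⟩
  rw [hp, hq, zpow_sub₀ hy0, zpow_natCast, zpow_natCast, mul_div_mul_comm]

theorem isUniformizer_of_adjoin_eq_top (hk : ∀ c : k, v (algebraMap k K c) ≤ 1)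
    (hgen : k⟮y⟯ = ⊤) (hy0 : y ≠ 0) (hy : v y < 1) : IsUniformizer v y := by
  refine ⟨hy0, hy, fun a ha => ?_⟩
  obtain ⟨n, p, q, hp, hq, rfl⟩ := exists_eq_zpow_mul_aeval_div_aeval hgen hy0 ha
  refine ⟨n, ?_⟩
  rw [map_mul, map_div₀, valuation_aeval_eq_one hk hy hp, valuation_aeval_eq_one hk hy hq,
    div_one, mul_one, map_zpow₀]

theorem exists_D_eq_smul_of_adjoin_eq_top (hk : ∀ c : k, v (algebraMap k K c) ≤ 1)
    (hgen : k⟮y⟯ = ⊤) (hy0 : y ≠ 0) (hy : v y < 1) {a : K} (ha : v a ≤ 1) :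
    ∃ b, v b ≤ 1 ∧ KaehlerDifferential.D k K a = b • KaehlerDifferential.D k K y := by
  have hu := isUniformizer_of_adjoin_eq_top hk hgen hy0 hy
  obtain ⟨p, q, hq, rfl⟩ : ∃ p q : k[X], v (aeval y q) = 1 ∧ a = aeval y p / aeval y q := by
    rcases eq_or_ne a 0 with rfl | ha0
    · exact ⟨0, 1, by simp, by simp⟩
    obtain ⟨n, p, q, hp, hq, rfl⟩ := exists_eq_zpow_mul_aeval_div_aeval hgen hy0 ha0
    rw [map_mul, map_div₀, valuation_aeval_eq_one hk hy hp, valuation_aeval_eq_one hk hy hq,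
      div_one, mul_one, map_zpow₀, ← zpow_zero (v y), hu.zpow_le_iff] at ha
    lift n to ℕ using ha
    refine ⟨X ^ n * p, q, valuation_aeval_eq_one hk hy hq, ?_⟩
    rw [map_mul, map_pow, aeval_X, zpow_natCast, mul_div_assoc]
  refine ⟨(aeval y q * aeval y (derivative p) - aeval y p * aeval y (derivative q)) / aeval y q ^ 2,
    ?_, ?_⟩
  · rw [map_div₀, map_pow, hq, one_pow, div_one]
    simp only [← map_mul, ← map_sub]
    exact valuation_aeval_le_one hk hy.le _
  · rw [Derivation.leibniz_div, Derivation.map_aeval, Derivation.map_aeval, smul_smul, smul_smul,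
      ← sub_smul, smul_smul, div_eq_inv_mul, inv_pow]

end RationalFunctionField

section RamificationIndex

variable {k F : Type*} [Field k] [Field F] [Algebra k F] {E : IntermediateField k F}
  {O : ValuationSubring F}

theorem HasRamificationIndex.valuation_eq_pow {e : ℕ} (h : HasRamificationIndex E O e) {y : E}
    (hy : IsUniformizer (O.valuation.comap (algebraMap E F)) y) {π : F}
    (hπ : IsUniformizer O.valuation π) : O.valuation (y : F) = O.valuation π ^ e := by
  have hyO : (y : F) ∈ O := (O.valuation_le_one_iff _).mp hy.lt_one.le
  refine le_antisymm ?_ ?_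
  · refine (hπ.mem_maximalIdeal_pow_iff e ⟨y, hyO⟩).mp (h ▸ Ideal.subset_span ⟨y.2, ?_⟩)
    exact (O.valuation_lt_one_iff _).mpr hy.lt_one
  · have hspan (b : O) (hb : b ∈ Ideal.span {a : O | (a : F) ∈ E ∧ a ∈ maximalIdeal O}) :
        O.valuation (b : F) ≤ O.valuation (y : F) := by
      induction hb using Submodule.span_induction with
      | mem a ha =>
        exact hy.valuation_le_of_lt_one (a := ⟨a, ha.1⟩) ((O.valuation_lt_one_iff a).mp ha.2)
      | zero => simp
      | add a b _ _ ha hb => exact (O.valuation.map_add _ _).trans (max_le ha hb)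
      | smul c a _ ha =>
        exact (O.valuation.map_mul c a).trans_le
          ((mul_le_of_le_one_left' (O.valuation_le_one c)).trans ha)
    have hπe : (⟨π, hπ.mem⟩ ^ e : O) ∈ maximalIdeal O ^ e :=
      (hπ.mem_maximalIdeal_pow_iff _ _).mpr (by simp)
    exact (map_pow O.valuation π e).ge.trans (hspan _ (h ▸ hπe))

end RamificationIndex

/-! ### Totally ramified extensions -/

section TotallyRamified

open Polynomial Module

variable {K L Γ₀ : Type*} [Field K] [Field L] [Algebra K L] [LinearOrderedCommGroupWithZero Γ₀]
  {v : Valuation L Γ₀} {t : K} {π : L}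

/-- The extension `L / K` is totally ramified for the discrete valuation `v` of `L`, in terms of
uniformizers `t` of `K` and `π` of `L`: the ramification index is the degree. -/
structure IsTotallyRamified (v : Valuation L Γ₀) (t : K) (π : L) : Prop where
  uniformizer_base : IsUniformizer (v.comap (algebraMap K L)) t
  uniformizer : IsUniformizer v π
  valuation_eq_pow : v (algebraMap K L t) = v π ^ finrank K L

namespace IsTotallyRamified

theorem finrank_pos (h : IsTotallyRamified v t π) : 0 < finrank K L :=
  Nat.pos_of_ne_zero fun h0 => h.uniformizer_base.lt_one.ne <|
    show v (algebraMap K L t) = 1 by rw [h.valuation_eq_pow, h0, pow_zero]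

theorem algebraMap_pos (h : IsTotallyRamified v t π) : 0 < v (algebraMap K L t) :=
  h.uniformizer_base.pos

theorem valuation_zpow (h : IsTotallyRamified v t π) (m : ℤ) :
    v (algebraMap K L t) ^ m = v π ^ (finrank K L * m) := by
  rw [h.valuation_eq_pow, zpow_mul, zpow_natCast]

theorem exists_valuation_smul_pow (h : IsTotallyRamified v t π) {c : K} (hc : c ≠ 0) :
    ∃ m : ℤ, v (algebraMap K L c) = v (algebraMap K L t) ^ m ∧
      ∀ i : ℕ, v (c • π ^ i) = v π ^ (finrank K L * m + i) := by
  obtain ⟨m, hm⟩ : ∃ m : ℤ, v (algebraMap K L c) = v (algebraMap K L t) ^ m :=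
    h.uniformizer_base.exists_zpow c hc
  refine ⟨m, hm, fun i => ?_⟩
  rw [Algebra.smul_def, map_mul, map_pow, hm, h.valuation_zpow, zpow_add₀ h.uniformizer.pos.ne',
    zpow_natCast]

/-- The valuations of the nonzero terms are distinct modulo the degree, so one term dominates. -/
theorem exists_valuation_sum_eq (h : IsTotallyRamified v t π) {c : Fin (finrank K L) → K}
    (hc : c ≠ 0) : ∃ j, c j ≠ 0 ∧ v (∑ i, c i • π ^ (i : ℕ)) = v (c j • π ^ (j : ℕ)) ∧
      ∀ i, v (c i • π ^ (i : ℕ)) ≤ v (c j • π ^ (j : ℕ)) := by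
  classical
  obtain ⟨i₀, hi₀⟩ := Function.ne_iff.mp hc
  obtain ⟨j, -, hmax⟩ := Finset.exists_max_image Finset.univ (fun i => v (c i • π ^ (i : ℕ)))
    ⟨i₀, Finset.mem_univ i₀⟩
  have hmax (i) : v (c i • π ^ (i : ℕ)) ≤ v (c j • π ^ (j : ℕ)) := hmax i (Finset.mem_univ i)
  have hpos {i} (hi : c i ≠ 0) : 0 < v (c i • π ^ (i : ℕ)) :=
    zero_lt_iff.mpr (v.ne_zero_iff.mpr (smul_ne_zero hi (pow_ne_zero _ h.uniformizer.ne_zero)))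
  have hj : c j ≠ 0 := by
    intro hj
    simpa only [hj, zero_smul, map_zero, not_lt_zero] using (hpos hi₀).trans_le (hmax i₀)
  refine ⟨j, hj, v.map_sum_eq_of_lt (Finset.mem_univ j) fun i hi => ?_, hmax⟩
  refine (hmax i).lt_of_ne fun heq => (by simpa using hi : i ≠ j) ?_
  have hi0 : c i ≠ 0 := fun hi0 => (hpos hj).ne' <| by rw [← heq, hi0, zero_smul, map_zero]
  obtain ⟨a, -, ha⟩ := h.exists_valuation_smul_pow hi0
  obtain ⟨b, -, hb⟩ := h.exists_valuation_smul_pow hj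
  rw [ha, hb, h.uniformizer.zpow_inj] at heq
  have hmod := congrArg (· % (finrank K L : ℤ)) heq
  simp only [Int.mul_add_emod_self_left, ← Int.natCast_mod, Nat.mod_eq_of_lt (Fin.is_lt _)] at hmod
  exact Fin.ext (by exact_mod_cast hmod)

theorem valuation_smul_pow_le (h : IsTotallyRamified v t π) (c : Fin (finrank K L) → K)
    (i : Fin (finrank K L)) : v (c i • π ^ (i : ℕ)) ≤ v (∑ j, c j • π ^ (j : ℕ)) := by
  rcases eq_or_ne c 0 with rfl | hc
  · simp
  · obtain ⟨j, -, hsum, hle⟩ := h.exists_valuation_sum_eq hc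
    exact hsum ▸ hle i

theorem valuation_coeff_eq_zpow (h : IsTotallyRamified v t π) {c : Fin (finrank K L) → K}
    {r : Fin (finrank K L)} {q : ℤ}
    (hsum : v (∑ i, c i • π ^ (i : ℕ)) = v π ^ (finrank K L * q + (r : ℕ))) :
    v (algebraMap K L (c r)) = v (algebraMap K L t) ^ q := by
  have hc : c ≠ 0 := by
    rintro rfl
    simpa using hsum.trans_ne (zpow_ne_zero _ h.uniformizer.pos.ne')
  obtain ⟨j, hj, hsum', -⟩ := h.exists_valuation_sum_eq hc
  obtain ⟨m, hm, hval⟩ := h.exists_valuation_smul_pow hj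
  rw [hsum', hval, h.uniformizer.zpow_inj] at hsum
  have hmod := congrArg (· % (finrank K L : ℤ)) hsum
  simp only [Int.mul_add_emod_self_left, ← Int.natCast_mod, Nat.mod_eq_of_lt (Fin.is_lt _)] at hmod
  obtain rfl : j = r := Fin.ext (by exact_mod_cast hmod)
  have hn : (finrank K L : ℤ) ≠ 0 := by exact_mod_cast h.finrank_pos.ne'
  rw [hm, mul_left_cancel₀ hn (add_right_cancel hsum)]

/-- The powers of a uniformizer of a totally ramified extension, as a power basis. -/
def powerBasis (h : IsTotallyRamified v t π) : PowerBasis K L where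
  gen := π
  dim := finrank K L
  basis :=
    haveI : Nonempty (Fin (finrank K L)) := ⟨⟨0, h.finrank_pos⟩⟩
    basisOfLinearIndependentOfCardEqFinrank (b := fun i : Fin (finrank K L) => π ^ (i : ℕ))
      (Fintype.linearIndependent_iff.mpr fun c hc => by
        by_contra! hne
        obtain ⟨j, hj, hsum, -⟩ := h.exists_valuation_sum_eq (Function.ne_iff.mpr hne)
        rw [hc, map_zero, eq_comm, v.zero_iff] at hsum
        exact smul_ne_zero hj (pow_ne_zero _ h.uniformizer.ne_zero) hsum)
      (Fintype.card_fin _)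
  basis_eq_pow i := by simp

theorem natDegree_minpoly (h : IsTotallyRamified v t π) :
    (minpoly K π).natDegree = finrank K L :=
  h.powerBasis.natDegree_minpoly

theorem monic_minpoly (h : IsTotallyRamified v t π) : (minpoly K π).Monic :=
  minpoly.monic h.powerBasis.isIntegral_gen

theorem sum_minpoly_coeff (h : IsTotallyRamified v t π) :
    ∑ i : Fin (finrank K L), (minpoly K π).coeff i • π ^ (i : ℕ) = -π ^ finrank K L := by
  have hzero := minpoly.aeval K π
  rwa [aeval_eq_sum_range, Finset.sum_range_succ, h.monic_minpoly.coeff_natDegree, one_smul,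
    h.natDegree_minpoly, Finset.sum_range, add_eq_zero_iff_eq_neg] at hzero

theorem valuation_minpoly_coeff_le (h : IsTotallyRamified v t π) {i : ℕ} (hi : i < finrank K L) :
    v (algebraMap K L ((minpoly K π).coeff i)) ≤ v (algebraMap K L t) := by
  rcases eq_or_ne ((minpoly K π).coeff i) 0 with h0 | h0
  · simp [h0]
  obtain ⟨m, hm, hval⟩ := h.exists_valuation_smul_pow h0
  have hle := h.valuation_smul_pow_le (fun j => (minpoly K π).coeff j) ⟨i, hi⟩
  rw [h.sum_minpoly_coeff, hval, Valuation.map_neg, map_pow, ← zpow_natCast,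
    h.uniformizer.zpow_le_iff] at hle
  have hm1 : 1 ≤ m := by
    by_contra! hm1
    nlinarith
  rw [hm]
  exact (zpow_le_zpow_right_of_le_one₀ h.algebraMap_pos h.uniformizer_base.lt_one.le
    hm1).trans_eq (zpow_one _)

theorem valuation_minpoly_coeff_zero (h : IsTotallyRamified v t π) :
    v (algebraMap K L ((minpoly K π).coeff 0)) = v (algebraMap K L t) := by
  rw [← zpow_one (v (algebraMap K L t))]
  refine h.valuation_coeff_eq_zpow (c := fun i => (minpoly K π).coeff i)
    (r := ⟨0, h.finrank_pos⟩) ?_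
  simp [h.sum_minpoly_coeff]

end IsTotallyRamified

theorem derivation_aeval {R A B M : Type*} [CommSemiring R] [CommSemiring A] [CommSemiring B]
    [AddCommMonoid M] [Algebra R A] [Algebra B A] [Module A M] [Module R M]
    (D : Derivation R A M) (g : B[X]) (w : A) :
    D (aeval w g) =
      aeval w (derivative g) • D w + g.sum fun i b => w ^ i • D (algebraMap B A b) := by
  induction g using Polynomial.induction_on' with
  | add p q hp hq =>
    rw [map_add, map_add, hp, hq, derivative_add, map_add, Polynomial.sum_add_index _ _ _ (by simp)
      (by simp), add_smul]
    abel
  | monomial n b =>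
    rw [Polynomial.sum_monomial_index _ _ (by simp), aeval_monomial, derivative_monomial,
      aeval_monomial, D.leibniz, D.leibniz_pow, map_mul, map_natCast, ← Nat.cast_smul_eq_nsmul A,
      smul_smul, smul_smul, mul_assoc]

namespace IsTotallyRamified

section Derivation

variable {R : Type*} [CommSemiring R] [Algebra R L] {D : Derivation R L L}

theorem valuation_derivation_eq (h : IsTotallyRamified v t π) (hDt : D (algebraMap K L t) ≠ 0)
    (hD : ∀ u : K, v (algebraMap K L u) ≤ 1 → v (D (algebraMap K L u)) ≤ v (D (algebraMap K L t)))
    {u : K} (hu : v (algebraMap K L u) = v (algebraMap K L t)) :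
    v (D (algebraMap K L u)) = v (D (algebraMap K L t)) := by
  have ht0 : t ≠ 0 := h.uniformizer_base.ne_zero
  have hvt : v (algebraMap K L t) < 1 := h.uniformizer_base.lt_one
  have he : v (algebraMap K L (u / t)) = 1 := by
    rw [map_div₀, map_div₀, hu, div_self h.algebraMap_pos.ne']
  have hDu : D (algebraMap K L u) = algebraMap K L t * D (algebraMap K L (u / t)) +
      algebraMap K L (u / t) * D (algebraMap K L t) := by
    rw [← smul_eq_mul, ← smul_eq_mul, ← D.leibniz, ← map_mul, mul_div_cancel₀ u ht0]
  have hlt : v (algebraMap K L t * D (algebraMap K L (u / t))) < v (D (algebraMap K L t)) := by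
    rw [map_mul]
    exact (mul_le_mul_right (hD _ he.le) _).trans_lt
      (mul_lt_of_lt_one_left (zero_lt_iff.mpr (v.ne_zero_iff.mpr hDt)) hvt)
  have hmain : v (algebraMap K L (u / t) * D (algebraMap K L t)) = v (D (algebraMap K L t)) := by
    rw [map_mul, he, one_mul]
  rw [hDu, v.map_add_eq_of_lt_right (hlt.trans_eq hmain.symm), hmain]

/-- Apply `D` to the Eisenstein equation of `π`: the constant coefficient contributes the term of
largest valuation. -/
theorem valuation_aeval_derivative_minpoly_mul (h : IsTotallyRamified v t π)
    (hDt : D (algebraMap K L t) ≠ 0)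
    (hD : ∀ u : K, v (algebraMap K L u) ≤ 1 → v (D (algebraMap K L u)) ≤ v (D (algebraMap K L t))) :
    v (aeval π (derivative (minpoly K π)) * D π) = v (D (algebraMap K L t)) := by
  have hzero := derivation_aeval D (minpoly K π) π
  rw [minpoly.aeval, map_zero, Polynomial.sum_over_range _ (by simp), Finset.sum_range_succ,
    h.monic_minpoly.coeff_natDegree, map_one, D.map_one_eq_zero,
    smul_zero, add_zero, h.natDegree_minpoly, smul_eq_mul, eq_comm, add_eq_zero_iff_eq_neg] at hzero
  have h0 := h.valuation_derivation_eq hDt hD h.valuation_minpoly_coeff_zero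
  rw [hzero, Valuation.map_neg,
    v.map_sum_eq_of_lt (Finset.mem_range.mpr h.finrank_pos) fun i hi => ?_]
  · rw [pow_zero, one_smul, h0]
  · obtain ⟨hi, hi0⟩ : i < finrank K L ∧ i ≠ 0 := by simpa using hi
    rw [pow_zero, one_smul, h0, smul_eq_mul, map_mul, map_pow]
    have hle := hD _ ((h.valuation_minpoly_coeff_le hi).trans h.uniformizer_base.lt_one.le)
    exact (mul_le_mul_right hle _).trans_lt (mul_lt_of_lt_one_left
      (zero_lt_iff.mpr (v.ne_zero_iff.mpr hDt)) (pow_lt_one₀ zero_le h.uniformizer.lt_one hi0))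

end Derivation

end IsTotallyRamified

/-- Euler's formula for the trace of `w / f'(α)`. -/
theorem trace_div_aeval_derivative [FiniteDimensional K L] [Algebra.IsSeparable K L]
    (pb : PowerBasis K L) (w : L) :
    Algebra.trace K L (w / aeval pb.gen (derivative (minpoly K pb.gen))) =
      pb.basis.repr w ⟨pb.dim - 1, Nat.sub_one_lt pb.dim_pos.ne'⟩ := by
  have hlead : (minpolyDiv K pb.gen).coeff (pb.dim - 1) = 1 := by
    rw [← pb.natDegree_minpoly, ← natDegree_minpolyDiv]
    exact minpolyDiv_monic pb.isIntegral_gen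
  have hdual := Module.Basis.traceDual_powerBasis_eq pb
    ⟨pb.dim - 1, Nat.sub_one_lt pb.dim_pos.ne'⟩
  rw [hlead] at hdual
  conv_rhs => rw [← pb.basis.traceDual_traceDual]
  rw [Module.Basis.traceDual_repr_apply, hdual, Algebra.traceForm_apply, mul_one_div]

namespace IsTotallyRamified

theorem valuation_trace [Algebra.IsSeparable K L] (h : IsTotallyRamified v t π) {w : L} {q : ℤ}
    (hw : v (w * aeval π (derivative (minpoly K π))) =
      v π ^ (finrank K L * q + (finrank K L - 1 : ℕ))) :
    v (algebraMap K L (Algebra.trace K L w)) = v (algebraMap K L t) ^ q := by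
  have : FiniteDimensional K L := Module.finite_of_finrank_pos h.finrank_pos
  set δ := aeval π (derivative (minpoly K π)) with hδ
  have hδ0 : δ ≠ 0 :=
    (Algebra.IsSeparable.isSeparable K π).aeval_derivative_ne_zero (minpoly.aeval _ _)
  have htrace := trace_div_aeval_derivative h.powerBasis (w * δ)
  rw [show h.powerBasis.gen = π from rfl, ← hδ, mul_div_cancel_right₀ w hδ0] at htrace
  rw [htrace]
  refine h.valuation_coeff_eq_zpow (c := h.powerBasis.basis.repr (w * δ))
    (r := ⟨finrank K L - 1, Nat.sub_one_lt h.finrank_pos.ne'⟩) ?_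
  rw [← hw]
  conv_rhs => rw [← h.powerBasis.basis.sum_repr (w * δ)]
  simp only [PowerBasis.basis_eq_pow]
  rfl

end IsTotallyRamified

end TotallyRamified

/-! ### Counting values -/

section Counting

open Finset

variable {k K Γ₀ : Type*} [Field k] [Field K] [Algebra k K] [LinearOrderedCommGroupWithZero Γ₀]
  {v : Valuation K Γ₀}

theorem exists_valuation_sub_smul_lt
    (hres : ∀ a, v a ≤ 1 → ∃ c : k, v (a - algebraMap k K c) < 1) {w w₀ : K} (hw₀ : w₀ ≠ 0)
    (hle : v w ≤ v w₀) : ∃ c : k, v (w - c • w₀) < v w₀ := by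
  obtain ⟨c, hc⟩ := hres (w / w₀) (by rw [map_div₀]; exact div_le_one_of_le₀ hle zero_le)
  refine ⟨c, ?_⟩
  rw [show w - c • w₀ = (w / w₀ - algebraMap k K c) * w₀ by
    rw [Algebra.smul_def, sub_mul, div_mul_cancel₀ w hw₀], map_mul]
  exact mul_lt_of_lt_one_left (zero_lt_iff.mpr (v.ne_zero_iff.mpr hw₀)) hc

/-- The elements of `V` of non-maximal value form a subspace of codimension at most one. -/
theorem finrank_le_card_of_valuation_mem (hk : ∀ c : k, v (algebraMap k K c) ≤ 1)
    (hres : ∀ a, v a ≤ 1 → ∃ c : k, v (a - algebraMap k K c) < 1) {V : Submodule k K}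
    {T : Finset Γ₀} (hT : ∀ w ∈ V, w ≠ 0 → v w ∈ T) : Module.finrank k V ≤ #T := by
  classical
  suffices h : ∃ s : Finset K, #s ≤ #T ∧ V ≤ Submodule.span k s by
    obtain ⟨s, hs, hV⟩ := h
    exact (Submodule.finrank_mono hV).trans ((finrank_span_finset_le_card s).trans hs)
  induction T using Finset.induction_on_max generalizing V with
  | empty => exact ⟨∅, le_rfl, fun w hw => by_contra fun hw0 =>
      notMem_empty _ (hT w hw fun h => hw0 (h ▸ zero_mem _))⟩
  | insert γ T hγ ih =>
    rw [card_insert_of_notMem fun h => (hγ γ h).false]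
    by_cases hmax : ∃ w₀ ∈ V, w₀ ≠ 0 ∧ v w₀ = γ
    · obtain ⟨w₀, hw₀, hw₀0, rfl⟩ := hmax
      let V' : Submodule k K :=
        { carrier := {w | w ∈ V ∧ v w < v w₀}
          zero_mem' := ⟨zero_mem V, by simpa [zero_lt_iff] using hw₀0⟩
          add_mem' := fun ha hb => ⟨add_mem ha.1 hb.1, v.map_add_lt ha.2 hb.2⟩
          smul_mem' := fun c w hw => ⟨V.smul_mem c hw.1, by
            rw [Algebra.smul_def, map_mul]
            exact (mul_le_of_le_one_left' (hk c)).trans_lt hw.2⟩ }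
      obtain ⟨s, hs, hV'⟩ := ih (V := V') fun w hw hw0 =>
        (mem_insert.mp (hT w hw.1 hw0)).resolve_left hw.2.ne
      refine ⟨insert w₀ s, (card_insert_le _ _).trans (Nat.succ_le_succ hs), fun w hw => ?_⟩
      have hle : v w ≤ v w₀ := by
        rcases eq_or_ne w 0 with rfl | hw0
        · simp
        · exact (mem_insert.mp (hT w hw hw0)).elim le_of_eq fun h => (hγ _ h).le
      obtain ⟨c, hc⟩ := exists_valuation_sub_smul_lt hres hw₀0 hle
      rw [coe_insert, Submodule.mem_span_insert]
      exact ⟨c, w - c • w₀, hV' ⟨sub_mem hw (V.smul_mem c hw₀), hc⟩, by abel⟩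
    · obtain ⟨s, hs, hV⟩ := ih fun w hw hw0 =>
        (mem_insert.mp (hT w hw hw0)).resolve_left fun h => hmax ⟨w, hw, hw0, h⟩
      exact ⟨s, hs.trans (Nat.le_succ _), hV⟩

theorem two_mul_card_le_of_add_ne {T : Finset ℤ} {a b : ℤ} (hT : T ⊆ Icc a b)
    (hadd : ∀ x ∈ T, ∀ y ∈ T, x + y ≠ a + b) : 2 * #T ≤ #(Icc a b) := by
  have hinj : Function.Injective fun x => a + b - x := sub_right_injective
  have hdisj : Disjoint T (T.image fun x => a + b - x) := by
    rw [disjoint_right]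
    rintro _ hy hyT
    obtain ⟨x, hx, rfl⟩ := mem_image.mp hy
    exact hadd x hx _ hyT (add_sub_cancel _ _)
  have hsub : T ∪ T.image (fun x => a + b - x) ⊆ Icc a b := by
    refine union_subset hT (image_subset_iff.mpr fun x hx => ?_)
    have := mem_Icc.mp (hT hx)
    exact mem_Icc.mpr ⟨by omega, by omega⟩
  calc 2 * #T = #T + #(T.image fun x => a + b - x) := by
        rw [card_image_of_injective T hinj, two_mul]
    _ = #(T ∪ T.image fun x => a + b - x) := (card_union_of_disjoint hdisj).symm
    _ ≤ #(Icc a b) := card_le_card hsub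

end Counting

section RegularOutside

variable {k F : Type*} [Field k] [Field F] [Algebra k F] {P : ValuationSubring F}

variable (k) in
/-- The ring of functions without poles outside `P`, that is, the coordinate ring of the affine
curve `X ∖ {P}`. -/
def regularOutside (P : ValuationSubring F) : Subalgebra k F where
  carrier := {w | ∀ O : ValuationSubring F, IsPlace k O → O ≠ P → w ∈ O}
  mul_mem' ha hb O hO hP := mul_mem (ha O hO hP) (hb O hO hP)
  add_mem' ha hb O hO hP := add_mem (ha O hO hP) (hb O hO hP)
  algebraMap_mem' c _ hO _ := hO.1 c

theorem isIntegral_of_mem_regularOutside {w : F} (hw : w ∈ regularOutside k P)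
    (hwP : w ∈ P) : IsIntegral k w :=
  isIntegral_of_forall_isPlace_mem fun O hO => by
    by_cases hOP : O = P
    · exact hOP ▸ hwP
    · exact hw O hO hOP

theorem eq_zero_of_mem_regularOutside (hP : IsPlace k P) {w : F} (hw : w ∈ regularOutside k P)
    (hlt : P.valuation w < 1) : w = 0 := by
  by_contra h0
  have hint : IsIntegral k w :=
    isIntegral_of_mem_regularOutside hw ((P.valuation_le_one_iff w).mp hlt.le)
  have hinv : w⁻¹ ∈ P := mem_of_isIntegral_adjoin (S := ∅) hP.1 (by simp)
    (hint.inv.tower_top (A := Algebra.adjoin k (∅ : Set F)))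
  rw [← P.valuation_le_one_iff, map_inv₀, inv_le_one₀ (by simpa [zero_lt_iff] using h0)] at hinv
  exact hlt.not_ge hinv

end RegularOutside

section SpanD

variable {k F : Type*} [Field k] [Field F] [Algebra k F]

theorem D_mem_span_of_mem_adjoin {x e : F} (he : e ∈ k⟮x⟯) :
    KaehlerDifferential.D k F e ∈ F ∙ KaehlerDifferential.D k F x := by
  induction he using IntermediateField.adjoin_induction with
  | mem y hy => exact Set.mem_singleton_iff.mp hy ▸ Submodule.mem_span_singleton_self _
  | algebraMap c => exact (KaehlerDifferential.D k F).map_algebraMap c ▸ zero_mem _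
  | add y z _ _ hy hz => exact (map_add (KaehlerDifferential.D k F) y z) ▸ add_mem hy hz
  | mul y z _ _ hy hz =>
    rw [Derivation.leibniz]
    exact add_mem (Submodule.smul_mem _ _ hz) (Submodule.smul_mem _ _ hy)
  | inv y _ hy =>
    rw [Derivation.leibniz_inv]
    exact Submodule.smul_mem _ _ hy

theorem span_D_eq_top (x : F) [Algebra.IsSeparable k⟮x⟯ F] :
    F ∙ KaehlerDifferential.D k F x = ⊤ := by
  rw [← top_le_iff, ← KaehlerDifferential.span_range_derivation, Submodule.span_le]
  rintro _ ⟨w, rfl⟩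
  have hsep := (Algebra.IsSeparable.isSeparable k⟮x⟯ w).aeval_derivative_ne_zero
    (minpoly.aeval k⟮x⟯ w)
  have hzero := derivation_aeval (KaehlerDifferential.D k F) (minpoly k⟮x⟯ w) w
  rw [minpoly.aeval, map_zero, eq_comm, add_eq_zero_iff_eq_neg] at hzero
  refine ((F ∙ KaehlerDifferential.D k F x).smul_mem_iff hsep).mp (hzero ▸ neg_mem ?_)
  exact Submodule.sum_mem _ fun i _ =>
    Submodule.smul_mem _ _ (D_mem_span_of_mem_adjoin ((minpoly k⟮x⟯ w).coeff i).2)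

end SpanD

/-! ### Covers of the line ramified at one point -/

section Cover

variable {k F : Type*} [Field k] [Field F] [Algebra k F]

theorem IsSmoothPlace.mem_regularDifferentialsAt_iff {O : ValuationSubring F}
    (hO : IsSmoothPlace k O) {π : F} (hπ : IsUniformizer O.valuation π) {η : Ω[F⁄k]} :
    η ∈ regularDifferentialsAt k O ↔ ∃ c ∈ O, η = c • KaehlerDifferential.D k F π := by
  refine ⟨fun h => ?_, fun ⟨c, hc, h⟩ => AddSubgroup.subset_closure ⟨c, hc, π, hπ.mem, h⟩⟩
  unfold regularDifferentialsAt at h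
  induction h using AddSubgroup.closure_induction with
  | mem η hη =>
    obtain ⟨b, hb, a, ha, rfl⟩ := hη
    obtain ⟨c, hc, hac⟩ := hO.exists_D_eq_smul π hπ a ha
    exact ⟨b * c, mul_mem hb hc, by rw [hac, smul_smul]⟩
  | zero => exact ⟨0, zero_mem O, (zero_smul F _).symm⟩
  | add η θ _ _ hη hθ =>
    obtain ⟨b, hb, rfl⟩ := hη
    obtain ⟨c, hc, rfl⟩ := hθ
    exact ⟨b + c, add_mem hb hc, (add_smul b c _).symm⟩
  | neg η _ hη =>
    obtain ⟨c, hc, rfl⟩ := hη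
    exact ⟨-c, neg_mem hc, (neg_smul c _).symm⟩

theorem adjoin_singleton_eq_top {E : IntermediateField k F} {y : E} (hy : k⟮(y : F)⟯ = E) :
    k⟮y⟯ = ⊤ :=
  IntermediateField.lift_injective E <| by
    rw [IntermediateField.lift_adjoin_simple, IntermediateField.lift_top, hy]

theorem adjoin_sub_algebraMap_singleton (x : F) (c : k) : k⟮x - algebraMap k F c⟯ = k⟮x⟯ := by
  refine le_antisymm (IntermediateField.adjoin_simple_le_iff.mpr ?_)
    (IntermediateField.adjoin_simple_le_iff.mpr ?_)
  · exact sub_mem (IntermediateField.mem_adjoin_simple_self k x) (algebraMap_mem _ c)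
  · have := add_mem (IntermediateField.mem_adjoin_simple_self k (x - algebraMap k F c))
      (algebraMap_mem k⟮x - algebraMap k F c⟯ c)
    rwa [sub_add_cancel] at this

variable (k) in
/-- The function `x` presents the curve `X` with function field `F` as a separable cover of `ℙ¹`
that is totally ramified at the point `P` above `x = ∞` and unramified elsewhere: the
Harbater–Katz–Gabber covers, without the condition that the cover be Galois. -/
structure IsTotallyRamifiedCover (P : ValuationSubring F) (x : F) : Prop where
  isPlace : IsPlace k P
  transcendental : Transcendental k x
  finite : FiniteDimensional k⟮x⟯ F
  isSeparable : Algebra.IsSeparable k⟮x⟯ F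
  totally_ramified : HasRamificationIndex k⟮x⟯ P (Module.finrank k⟮x⟯ F)
  unramified : ∀ O : ValuationSubring F, IsPlace k O → O ≠ P → HasRamificationIndex k⟮x⟯ O 1
  regular : x ∈ regularOutside k P

namespace IsTotallyRamifiedCover

variable {P : ValuationSubring F} {x : F}

theorem rank_le_one (hX : IsTotallyRamifiedCover k P x) : Module.rank F Ω[F⁄k] ≤ 1 := by
  have := hX.isSeparable
  refine rank_le_one_iff.mpr ⟨KaehlerDifferential.D k F x, fun η => ?_⟩
  exact Submodule.mem_span_singleton.mp (span_D_eq_top (k := k) x ▸ Submodule.mem_top)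

theorem isSmoothPlace [IsAlgClosed k] (hX : IsTotallyRamifiedCover k P x)
    {O : ValuationSubring F} (hO : IsPlace k O) : IsSmoothPlace k O :=
  have := hX.finite
  have := hX.isSeparable
  hO.isSmoothPlace hX.transcendental

theorem ne_zero (hX : IsTotallyRamifiedCover k P x) : x ≠ 0 := fun h =>
  hX.transcendental (h ▸ isAlgebraic_zero)

theorem notMem (hX : IsTotallyRamifiedCover k P x) : x ∉ P := fun h =>
  hX.transcendental (isIntegral_of_mem_regularOutside hX.regular h).isAlgebraic

theorem valuation_inv_lt_one (hX : IsTotallyRamifiedCover k P x) : P.valuation x⁻¹ < 1 := by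
  rw [map_inv₀, inv_lt_one₀ (zero_lt_iff.mpr (P.valuation.ne_zero_iff.mpr hX.ne_zero)), ← not_le,
    P.valuation_le_one_iff]
  exact hX.notMem

theorem isUniformizer_comap {O : ValuationSubring F} (hO : IsPlace k O) {y : k⟮x⟯}
    (hy : k⟮(y : F)⟯ = k⟮x⟯) (hy0 : y ≠ 0) (hlt : O.valuation y < 1) :
    IsUniformizer (O.valuation.comap (algebraMap k⟮x⟯ F)) y :=
  isUniformizer_of_adjoin_eq_top (fun c => (O.valuation_le_one_iff _).mpr (hO.1 c))
    (adjoin_singleton_eq_top hy) hy0 hlt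

open IntermediateField.AdjoinSimple in
theorem isTotallyRamified (hX : IsTotallyRamifiedCover k P x) {π : F}
    (hπ : IsUniformizer P.valuation π) :
    IsTotallyRamified P.valuation (gen k x)⁻¹ π := by
  have hbase := isUniformizer_comap hX.isPlace (y := (gen k x)⁻¹) (adjoin_inv_singleton x)
    (inv_ne_zero fun h => hX.ne_zero (congrArg Subtype.val h)) hX.valuation_inv_lt_one
  exact ⟨hbase, hπ, hX.totally_ramified.valuation_eq_pow hbase hπ⟩

theorem exists_isUniformizer_sub [IsAlgClosed k] (hX : IsTotallyRamifiedCover k P x)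
    {O : ValuationSubring F} (hO : IsPlace k O) (hOP : O ≠ P) :
    ∃ c : k, IsUniformizer O.valuation (x - algebraMap k F c) := by
  have := (hX.isSmoothPlace hO).isDiscreteValuationRing
  obtain ⟨π, hπ⟩ := exists_isUniformizer O
  obtain ⟨c, hc⟩ := (hX.isSmoothPlace hO).exists_valuation_sub_lt_one x (hX.regular O hO hOP)
  have h0 : x - algebraMap k F c ≠ 0 := fun h =>
    hX.transcendental (sub_eq_zero.mp h ▸ isAlgebraic_algebraMap c)
  let y : k⟮x⟯ := IntermediateField.AdjoinSimple.gen k x - algebraMap k k⟮x⟯ c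
  have hy := isUniformizer_comap hO (y := y) (adjoin_sub_algebraMap_singleton x c)
    (fun h => h0 (congrArg Subtype.val h)) hc
  have hval : O.valuation (x - algebraMap k F c) = O.valuation π :=
    ((hX.unramified O hO hOP).valuation_eq_pow hy hπ).trans (pow_one _)
  exact ⟨c, h0, hc, hval ▸ hπ.exists_zpow⟩

theorem mem_regularDifferentialsAt_iff [IsAlgClosed k] (hX : IsTotallyRamifiedCover k P x)
    {O : ValuationSubring F} (hO : IsPlace k O) (hOP : O ≠ P) {η : Ω[F⁄k]} :
    η ∈ regularDifferentialsAt k O ↔ ∃ c ∈ O, η = c • KaehlerDifferential.D k F x := by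
  obtain ⟨c, hc⟩ := hX.exists_isUniformizer_sub hO hOP
  rw [(hX.isSmoothPlace hO).mem_regularDifferentialsAt_iff hc, map_sub, Derivation.map_algebraMap,
    sub_zero]

open IntermediateField.algebraAdjoinAdjoin in
theorem trace_mem_regularOutside (hX : IsTotallyRamifiedCover k P x) {w : F}
    (hw : w ∈ regularOutside k P) : (Algebra.trace k⟮x⟯ F w : F) ∈ regularOutside k P := by
  have := hX.finite
  have hint : IsIntegral (Algebra.adjoin k {x}) w := isIntegral_adjoin_of_forall_mem
    fun O hO hxO => by
      by_cases htop : O = ⊤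
      · exact htop ▸ ValuationSubring.mem_top w
      · exact hw O ⟨hO, htop⟩ (by rintro rfl; exact hX.notMem (hxO x rfl))
  have hint' : IsIntegral (Algebra.adjoin k {x}) (Algebra.trace k⟮x⟯ F w : F) :=
    (Algebra.isIntegral_trace (L := k⟮x⟯) hint).algebraMap
  exact fun O hO hOP => mem_of_isIntegral_adjoin hO.1
    (by rintro _ rfl; exact hX.regular O hO hOP) hint'

open IntermediateField.AdjoinSimple in
theorem exists_D_algebraMap_eq_smul (hX : IsTotallyRamifiedCover k P x) {u : k⟮x⟯}
    (hu : P.valuation (u : F) ≤ 1) : ∃ b : F, P.valuation b ≤ 1 ∧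
      KaehlerDifferential.D k F u = b • KaehlerDifferential.D k F x⁻¹ := by
  obtain ⟨b, hb, hD⟩ := exists_D_eq_smul_of_adjoin_eq_top
    (v := P.valuation.comap (algebraMap k⟮x⟯ F)) (y := (gen k x)⁻¹)
    (fun c => (P.valuation_le_one_iff _).mpr (hX.isPlace.1 c))
    (adjoin_singleton_eq_top (adjoin_inv_singleton x))
    (inv_ne_zero fun h => hX.ne_zero (congrArg Subtype.val h)) hX.valuation_inv_lt_one hu
  have hmap := congrArg (KaehlerDifferential.map k k k⟮x⟯ F) hD
  rw [map_smul, KaehlerDifferential.map_D, KaehlerDifferential.map_D] at hmap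
  exact ⟨b, hb, hmap⟩

section Coordinate

variable {l : Ω[F⁄k] →ₗ[F] F} (hl : l (KaehlerDifferential.D k F x) = 1) {π : F}
  (hπ : IsUniformizer P.valuation π)

include hl

theorem eq_smul_D (hX : IsTotallyRamifiedCover k P x) (η : Ω[F⁄k]) :
    η = l η • KaehlerDifferential.D k F x := by
  have := hX.isSeparable
  obtain ⟨c, rfl⟩ := Submodule.mem_span_singleton.mp
    (span_D_eq_top (k := k) x ▸ Submodule.mem_top : η ∈ F ∙ KaehlerDifferential.D k F x)
  rw [map_smul, hl, smul_eq_mul, mul_one]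

theorem map_D_inv : l (KaehlerDifferential.D k F x⁻¹) = -x⁻¹ ^ 2 := by
  rw [Derivation.leibniz_inv, map_smul, hl, smul_eq_mul, mul_one]

include hπ

theorem map_D_ne_zero [IsAlgClosed k] (hX : IsTotallyRamifiedCover k P x) :
    l (KaehlerDifferential.D k F π) ≠ 0 := by
  intro h0
  obtain ⟨c, -, hc⟩ := (hX.isSmoothPlace hX.isPlace).exists_D_eq_smul π hπ x⁻¹
    ((P.valuation_le_one_iff _).mp hX.valuation_inv_lt_one.le)
  have hinv := map_D_inv hl
  rw [hc, map_smul, h0, smul_zero, eq_comm, neg_eq_zero] at hinv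
  exact pow_ne_zero 2 (inv_ne_zero hX.ne_zero) hinv

theorem mem_holomorphicDifferentials_iff [IsAlgClosed k] (hX : IsTotallyRamifiedCover k P x)
    {η : Ω[F⁄k]} : η ∈ holomorphicDifferentials k F ↔ l η ∈ regularOutside k P ∧
      P.valuation (l η) ≤ P.valuation (l (KaehlerDifferential.D k F π)) := by
  have hPsmooth := hX.isSmoothPlace hX.isPlace
  refine ⟨fun h => ⟨fun O hO hOP => ?_, ?_⟩, fun ⟨hout, hP⟩ O hO => ?_⟩
  · obtain ⟨c, hc, hη⟩ := (hX.mem_regularDifferentialsAt_iff hO hOP).mp (h O hO)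
    rwa [hη, map_smul, hl, smul_eq_mul, mul_one]
  · obtain ⟨c, hc, hη⟩ := (hPsmooth.mem_regularDifferentialsAt_iff hπ).mp (h P hX.isPlace)
    rw [hη, map_smul, smul_eq_mul, map_mul]
    exact mul_le_of_le_one_left' ((P.valuation_le_one_iff c).mpr hc)
  · by_cases hOP : O = P
    · subst hOP
      obtain ⟨c, hc⟩ := (O.valuation_le_iff _ _).mp hP
      refine (hPsmooth.mem_regularDifferentialsAt_iff hπ).mpr ⟨c, c.2, ?_⟩
      rw [hX.eq_smul_D hl η, ← hc, mul_smul, ← hX.eq_smul_D hl]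
    · exact (hX.mem_regularDifferentialsAt_iff hO hOP).mpr
        ⟨l η, hout O hO hOP, hX.eq_smul_D hl η⟩

/-- That is, `w dx` does not have a simple pole at `P`: otherwise the trace of `w` would be a
nonzero function in `k(x)` vanishing at `P` and without poles. -/
theorem valuation_mul_ne_valuation_map_D (hX : IsTotallyRamifiedCover k P x) {w : F}
    (hw : w ∈ regularOutside k P) :
    P.valuation (w * π) ≠ P.valuation (l (KaehlerDifferential.D k F π)) := by
  intro hwπ
  have := hX.isSeparable
  have hram := hX.isTotallyRamified hπ
  let D : Derivation k F F := l.compDer (KaehlerDifferential.D k F)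
  have hDt : D x⁻¹ = -x⁻¹ ^ 2 := map_D_inv hl
  have hdiff : P.valuation (Polynomial.aeval π (minpoly k⟮x⟯ π).derivative * D π) =
      P.valuation (D x⁻¹) := by
    refine hram.valuation_aeval_derivative_minpoly_mul (D := D) ?_ fun u hu => ?_
    · exact hDt.trans_ne (neg_ne_zero.mpr (pow_ne_zero 2 (inv_ne_zero hX.ne_zero)))
    · obtain ⟨b, hb, hDu⟩ := hX.exists_D_algebraMap_eq_smul hu
      change P.valuation (l (KaehlerDifferential.D k F u)) ≤
        P.valuation (l (KaehlerDifferential.D k F x⁻¹))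
      rw [hDu, map_smul, smul_eq_mul, map_mul]
      exact mul_le_of_le_one_left' hb
  have htrace : P.valuation (Algebra.trace k⟮x⟯ F w : F) = P.valuation x⁻¹ := by
    refine (hram.valuation_trace (q := 1) ?_).trans (zpow_one _)
    refine mul_right_cancel₀ hπ.pos.ne' ?_
    have hn := hram.finrank_pos
    have ht : P.valuation x⁻¹ = P.valuation π ^ Module.finrank k⟮x⟯ F := hram.valuation_eq_pow
    rw [← map_mul, mul_right_comm, map_mul, hwπ, ← map_mul, mul_comm]
    refine hdiff.trans ?_
    rw [hDt, Valuation.map_neg, map_pow, ht, ← zpow_add_one₀ hπ.pos.ne', ← pow_mul, ← zpow_natCast]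
    congr 1
    omega
  have hzero := eq_zero_of_mem_regularOutside hX.isPlace (hX.trace_mem_regularOutside hw)
    (htrace ▸ hX.valuation_inv_lt_one)
  rw [hzero, map_zero, eq_comm, P.valuation.zero_iff] at htrace
  exact inv_ne_zero hX.ne_zero htrace

theorem genus_le_card [IsAlgClosed k] (hX : IsTotallyRamifiedCover k P x)
    {T : Finset P.ValueGroup} (hT : ∀ w ∈ regularOutside k P, w ≠ 0 →
      P.valuation w ≤ P.valuation (l (KaehlerDifferential.D k F π)) → P.valuation w ∈ T) :
    genus k F ≤ T.card := by
  have hinj : Function.Injective (l.restrictScalars k) := fun η θ h => by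
    rw [hX.eq_smul_D hl η, hX.eq_smul_D hl θ, show l η = l θ from h]
  refine (Submodule.equivMapOfInjective _ hinj (holomorphicDifferentials k F)).finrank_eq.trans_le
    (finrank_le_card_of_valuation_mem (v := P.valuation) (fun c => ?_) (fun a ha => ?_) ?_)
  · exact (P.valuation_le_one_iff _).mpr (hX.isPlace.1 c)
  · exact (hX.isSmoothPlace hX.isPlace).exists_valuation_sub_lt_one a
      ((P.valuation_le_one_iff a).mp ha)
  · rintro _ ⟨η, hη, rfl⟩ hη0
    obtain ⟨hreg, hle⟩ := (mem_holomorphicDifferentials_iff hl hπ hX).mp hη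
    exact hT _ hreg hη0 hle

theorem two_mul_genus_le [IsAlgClosed k] (hX : IsTotallyRamifiedCover k P x) {d : ℤ}
    (hd : P.valuation (l (KaehlerDifferential.D k F π)) = P.valuation π ^ (-d)) :
    2 * genus k F ≤ (d + 2).toNat := by
  classical
  let S : Finset ℤ := {m ∈ Finset.Icc (-d) 0 |
    ∃ w ∈ regularOutside k P, P.valuation w = P.valuation π ^ m}
  have hS : 2 * S.card ≤ (Finset.Icc (-(d + 1)) 0).card := by
    refine two_mul_card_le_of_add_ne ((Finset.filter_subset _ _).trans
      (Finset.Icc_subset_Icc_left (by omega))) fun m hm m' hm' hsum => ?_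
    obtain ⟨-, w, hw, hwm⟩ := Finset.mem_filter.mp hm
    obtain ⟨-, w', hw', hwm'⟩ := Finset.mem_filter.mp hm'
    refine valuation_mul_ne_valuation_map_D hl hπ hX (mul_mem hw hw') ?_
    rw [map_mul, map_mul, hwm, hwm', hd, ← zpow_add₀ hπ.pos.ne', ← zpow_add_one₀ hπ.pos.ne']
    congr 1
    omega
  have hgenus : genus k F ≤ (S.image (P.valuation π ^ ·)).card := by
    refine genus_le_card hl hπ hX fun w hw hw0 hle => ?_
    obtain ⟨m, hm⟩ := hπ.exists_zpow w hw0
    have hm0 : ¬P.valuation π ^ m < 1 := fun hlt =>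
      hw0 (eq_zero_of_mem_regularOutside hX.isPlace hw (hm.trans_lt hlt))
    rw [← zpow_zero (P.valuation π), hπ.zpow_lt_iff, not_lt] at hm0
    have hdm : -d ≤ m := hπ.zpow_le_iff.mp (hm ▸ hd ▸ hle)
    exact Finset.mem_image.mpr
      ⟨m, Finset.mem_filter.mpr ⟨Finset.mem_Icc.mpr ⟨hdm, hm0⟩, w, hw, hm⟩, hm.symm⟩
  have hcard : (S.image (P.valuation π ^ ·)).card ≤ S.card := Finset.card_image_le
  rw [Int.card_Icc] at hS
  omega

end Coordinate

theorem smul_D_mem_holomorphicDifferentials [IsAlgClosed k] (hX : IsTotallyRamifiedCover k P x)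
    {π : F} (hπ : IsUniformizer P.valuation π) {w : F} (hw : w ∈ regularOutside k P) {n : ℕ}
    (hwn : P.valuation w ≤ P.valuation π ^ (-(n : ℤ))) (hn : (n : ℤ) ≤ 2 * genus k F - 2) :
    w • KaehlerDifferential.D k F x ∈ holomorphicDifferentials k F := by
  by_cases hDx : KaehlerDifferential.D k F x = 0
  · rw [hDx, smul_zero]
    exact zero_mem _
  obtain ⟨l, hl⟩ := Module.Projective.exists_dual_eq_one F hDx
  obtain ⟨m, hm⟩ := hπ.exists_zpow _ (map_D_ne_zero hl hπ hX)
  have hgenus : 2 * genus k F ≤ (-m + 2).toNat :=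
    two_mul_genus_le hl hπ hX (by rw [hm, neg_neg])
  rw [mem_holomorphicDifferentials_iff hl hπ hX, map_smul, hl, smul_eq_mul, mul_one, hm]
  exact ⟨hw, hwn.trans (hπ.zpow_le_iff.mpr (by omega))⟩

end IsTotallyRamifiedCover

theorem IsUniformizer.valuation_prod_pow_le {ι : Type*} {O : ValuationSubring F} {π : F}
    (hπ : IsUniformizer O.valuation π) (s : Finset ι) (f : ι → F) (L : ι → ℕ) :
    O.valuation (∏ i ∈ s, f i ^ L i) ≤
      O.valuation π ^ (-((∑ i ∈ s, L i * poleOrder O (f i) : ℕ) : ℤ)) := by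
  induction s using Finset.cons_induction with
  | empty => simp
  | cons i s hi ih =>
    rw [Finset.prod_cons, Finset.sum_cons, map_mul, map_pow, Nat.cast_add, neg_add,
      zpow_add₀ hπ.pos.ne', Nat.cast_mul, mul_comm (L i : ℤ), ← neg_mul, zpow_mul, zpow_natCast]
    exact mul_le_mul' (pow_le_pow_left' (hπ.poleOrder_le_iff.mp le_rfl) _) ih

theorem ι_mul_ι_sub_ι_mul_ι_mem_canonicalIdeal (h : Module.rank F Ω[F⁄k] ≤ 1) {θ : Ω[F⁄k]}
    {a b c d : F} (habcd : a * b = c * d) (ha : a • θ ∈ holomorphicDifferentials k F)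
    (hb : b • θ ∈ holomorphicDifferentials k F) (hc : c • θ ∈ holomorphicDifferentials k F)
    (hd : d • θ ∈ holomorphicDifferentials k F) :
    SymmetricAlgebra.ι k _ ⟨a • θ, ha⟩ * SymmetricAlgebra.ι k _ ⟨b • θ, hb⟩ -
      SymmetricAlgebra.ι k _ ⟨c • θ, hc⟩ * SymmetricAlgebra.ι k _ ⟨d • θ, hd⟩ ∈
        canonicalIdeal h := by
  have hmul : TensorAlgebra.ι F (a • θ) * TensorAlgebra.ι F (b • θ) =
      TensorAlgebra.ι F (c • θ) * TensorAlgebra.ι F (d • θ) := by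
    simp only [map_smul, smul_mul_smul_comm, habcd]
  change canonicalMap h _ = 0
  rw [map_sub, map_mul, map_mul, sub_eq_zero]
  simp only [canonicalMap_ι, DirectSum.of_mul_of]
  exact congrArg _ (Subtype.ext hmul)

namespace IsHKGCover

variable {r p : ℕ} {P : ValuationSubring F} {f : Fin (r + 1) → F}

theorem isTotallyRamifiedCover (hX : IsHKGCover (k := k) p P f) :
    IsTotallyRamifiedCover k P (f 0) :=
  have := hX.isGalois
  ⟨hX.isPlace, hX.transcendental, hX.finite, inferInstance, hX.totally_ramified, hX.unramified,
    hX.regular 0⟩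

theorem sum_mul_poleOrder_le_norm [IsAlgClosed k] (hX : IsHKGCover (k := k) p P f)
    (L : Fin (r + 1) → ℕ) : ∑ i, L i * poleOrder P (f i) ≤ norm k P f L := by
  have := hX.isGalois
  have := hX.finite
  have hcover := hX.isTotallyRamifiedCover
  have := (hcover.isSmoothPlace hX.isPlace).isDiscreteValuationRing
  obtain ⟨π, hπ⟩ := exists_isUniformizer P
  have hval : P.valuation (f 0)⁻¹ = P.valuation π ^ Module.finrank k⟮f 0⟯ F :=
    (hcover.isTotallyRamified hπ).valuation_eq_pow
  have h0 : poleOrder P (f 0) ≤ Nat.card Gal(F/k⟮f 0⟯) := by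
    rw [hπ.poleOrder_le_iff, IsGalois.card_aut_eq_finrank, zpow_neg, zpow_natCast, ← hval,
      map_inv₀, inv_inv]
  rw [Fin.sum_univ_succ, norm]
  gcongr

theorem sum_mul_poleOrder_le_of_mem_indexSet [IsAlgClosed k] (hX : IsHKGCover (k := k) p P f)
    {L : Fin (r + 1) → ℕ} (hL : L ∈ indexSet k P f) :
    ((∑ i, L i * poleOrder P (f i) : ℕ) : ℤ) ≤ 2 * (genus k F : ℤ) - 2 :=
  (Int.ofNat_le.mpr (hX.sum_mul_poleOrder_le_norm L)).trans hL

end IsHKGCover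

end Cover

end HKG

end

theorem proposition4p1_general {k F ι : Type*} [Field k] [IsAlgClosed k] [Field F] [Algebra k F]
    [Fintype ι] {P : ValuationSubring F} {x : F} (hX : HKG.IsTotallyRamifiedCover k P x)
    {f : ι → F} (hf : ∀ i, f i ∈ HKG.regularOutside k P) :
    ∃ h : ∀ L : ι → ℕ,
        ((∑ i, L i * HKG.poleOrder P (f i) : ℕ) : ℤ) ≤ 2 * (HKG.genus k F : ℤ) - 2 →
          (∏ i, f i ^ L i) • KaehlerDifferential.D k F x ∈ HKG.holomorphicDifferentials k F,
      ∀ L K L' K' hL hK hL' hK', L + K = L' + K' →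
        SymmetricAlgebra.ι k _ ⟨_, h L hL⟩ * SymmetricAlgebra.ι k _ ⟨_, h K hK⟩ -
          SymmetricAlgebra.ι k _ ⟨_, h L' hL'⟩ * SymmetricAlgebra.ι k _ ⟨_, h K' hK'⟩ ∈
            HKG.canonicalIdeal hX.rank_le_one := by
  have := (hX.isSmoothPlace hX.isPlace).isDiscreteValuationRing
  obtain ⟨π, hπ⟩ := HKG.exists_isUniformizer P
  refine ⟨fun L hL => ?_, fun L K L' K' _ _ _ _ hsum => ?_⟩
  · exact hX.smul_D_mem_holomorphicDifferentials hπ (prod_mem fun i _ => pow_mem (hf i) _)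
      (hπ.valuation_prod_pow_le _ _ _) hL
  · refine HKG.ι_mul_ι_sub_ι_mul_ι_mem_canonicalIdeal _ ?_ _ _ _ _
    have hadd (M N : ι → ℕ) : (∏ i, f i ^ M i) * ∏ i, f i ^ N i = ∏ i, f i ^ (M + N) i := by
      simp only [Pi.add_apply, pow_add, Finset.prod_mul_distrib]
    rw [hadd, hadd, hsum]

theorem proposition4p1 {k F : Type*} [Field k] [IsAlgClosed k] [Field F] [Algebra k F]
    (p : ℕ) [Fact p.Prime] [CharP k p] (r : ℕ)
    (P : ValuationSubring F) (f : Fin (r + 1) → F) (hX : HKG.IsHKGCover (k := k) p P f) :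
    ∃ h : ∀ L ∈ HKG.indexSet k P f, HKG.omega k f L ∈ HKG.holomorphicDifferentials k F,
      HKG.binomials h ⊆ (HKG.canonicalIdeal hX.rank_le_one : Set _) := by
  obtain ⟨h, hbin⟩ := proposition4p1_general hX.isTotallyRamifiedCover (f := f) hX.regular
  have hle (L : HKG.indexSet k P f) := hX.sum_mul_poleOrder_le_of_mem_indexSet L.2
  refine ⟨fun L hL => h L (hle ⟨L, hL⟩), ?_⟩
  rintro _ ⟨L, K, L', K', hsum, rfl⟩
  exact hbin L K L' K' (hle L) (hle K) (hle L') (hle K') hsum
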